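/- Let $d\ge 1$ and let $\varrho$ be a nonzero finite positive measure whose support is compact and contained in $[a,\infty)$ for some $a>0$. Put $V(t):=-\log\int\varrho(\mathrm d\kappa)\,e^{-\kappa t^2/2}$, $t\in\mathbb R$. Let $\mathbb B(\Lambda)$ be the set of positively oriented nearest-neighbor edges of $\mathbb Z^d$ with both endpoints in $\Lambda\subset\mathbb Z^d$. A configuration $\eta=(\eta_b)\in\mathbb R^{\mathbb B(\mathbb Z^d)}$, extended by $\eta_{yx}=-\eta_{xy}$, obeys the loop conditions if the sum of $\eta$ around every cycle of length four in $\mathbb Z^d$ vanishes. For finite $\Lambda\subset\mathbb Z^d$ and such an $\eta$, let $\nu_\Lambda^{(\eta)}$ be the Lebesgue measure on the finite-dimensional affine space of all $\eta'$ that obey the loop conditions and satisfy $\eta'_b=\eta_b$ for $b\notin\mathbb B(\Lambda)$, and let $$\gamma_\Lambda(\mathrm d\eta'\mid\eta):=\frac1{Z_\Lambda(\eta)}\exp\Bigl\{-\sum_{\langle x,y\rangle:\ x\in\Lambda \text{ or } y\in\Lambda}V(\eta'_{xy})\Bigr\}\,\nu_\Lambda^{(\eta)}(\mathrm d\eta'),$$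 with $Z_\Lambda(\eta)$ the normalizing constant. A probability measure $\mu$ on $\mathbb R^{\mathbb B(\mathbb Z^d)}$ is a gradient Gibbs measure for $V$ if $\mu$-a.e. $\eta$ obeys the loop conditions and if, for every finite $\Lambda$, its regular conditional probability given $\sigma(\eta_b: b\notin\mathbb B(\Lambda))$ equals $\gamma_\Lambda(\cdot\mid\eta)$ for $\mu$-a.e. $\eta$. With $(\tau_x\eta)_{yz}:=\eta_{y+x,z+x}$, $\mu$ is translation-invariant if $\mu\circ\tau_x^{-1}=\mu$ for all $x\in\mathbb Z^d$, ergodic if $\mu(A)\in\{0,1\}$ for every event $A$ with $\tau_x^{-1}(A)=A$ for all $x$, and of zero tilt if every $\eta_b$ is $\mu$-integrable with $E_\mu(\eta_b)=0$. For $\eta$ obeying the loop conditions let $(\phi_x)_{x\in\mathbb Z^d}$ be the unique field with $\phi_0=0$ and $\eta_{xy}=\phi_y-\phi_x$ for all edges, and let $\phi(f):=\int_{\mathbb R^d}f(x)\,\phi_{\lfloor x\rfloor}\,\mathrm dx$, where $\lfloor\cdot\rfloor$ is taken coordinatewise. Let $\mathcal H_0:=\{\Delta g: g\in C_0^\infty(\mathbb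 R^d)\}$ with the norm $$\|\Delta g\|_{\mathcal H}:=\Bigl(\int_{\mathbb R^d}\bigl(|\Delta g(x)|^2+|\nabla g(x)|^2\bigr)\,\mathrm dx\Bigr)^{1/2},$$ and let $\mathcal H$ be the completion of $\mathcal H_0$ in this norm. Let $\mu$ be a translation-invariant, ergodic, zero-tilt gradient Gibbs measure for $V$. Then there is a constant $c<\infty$ such that, for every $f\in\mathcal H_0$, $\phi(f)\in L^2(\mu)$ and $$\|\phi(f)\|_{L^2(\mu)}\le c\,\|f\|_{\mathcal H}.$$ In particular, $f\mapsto\phi(f)$ extends uniquely to a continuous linear map from $\mathcal H$ to $L^2(\mu)$. -/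

import Mathlib

noncomputable section

namespace GradientField

open MeasureTheory ProbabilityTheory
open scoped ContDiff Laplacian Gradient

/-! ### Lattice, edges and gradient configurations -/

/-- The sites of the lattice `ℤ^d`. -/
abbrev Site (d : ℕ) : Type := Fin d → ℤ

/-- The positively oriented nearest-neighbour edges of `ℤ^d`: the pair `(x, i)` stands for the
edge from `x` to `x + e_i`. -/
abbrev Edge (d : ℕ) : Type := Site d × Fin d

/-- Configurations of gradient variables, i.e. elements of `ℝ^{𝔹(ℤ^d)}` with the product
`σ`-algebra. -/
abbrev Config (d : ℕ) : Type := Edge d → ℝ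

/-- The `i`-th coordinate unit vector of `ℤ^d`. -/
def unitVec {d : ℕ} (i : Fin d) : Site d := Pi.single i 1

/-- The end point `x + e_i` of the edge `(x, i)`; its starting point is `b.1`. -/
def Edge.head {d : ℕ} (b : Edge d) : Site d := b.1 + unitVec b.2

/-- The loop conditions: the signed sum of `η` around every cycle of length four vanishes.
Each such cycle of `ℤ^d` is `x, x + e_i, x + e_i + e_j, x + e_j` for some `x` and `i ≠ j`, up to
orientation and starting point; for `i = j` the equation is trivially true. -/
def LoopCondition {d : ℕ} (η : Config d) : Prop :=
  ∀ (x : Site d) (i j : Fin d),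
    η (x, i) + η (x + unitVec i, j) - η (x + unitVec j, i) - η (x, j) = 0

/-- `𝔹(Λ)`: the edges with both end points in `Λ`. -/
def edgesIn {d : ℕ} (Λ : Finset (Site d)) : Finset (Edge d) :=
  (Λ ×ˢ Finset.univ).filter fun b => Edge.head b ∈ Λ

/-- The edges `⟨x, y⟩` with `x ∈ Λ` and `y ∈ Λ ∪ ∂Λ`, i.e. those with an end point in `Λ`. -/
def edgesTouching {d : ℕ} (Λ : Finset (Site d)) : Finset (Edge d) :=
  (Λ ×ˢ Finset.univ) ∪ (Λ ×ˢ Finset.univ).image fun b => (b.1 - unitVec b.2, b.2)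

/-! ### The specification and gradient Gibbs measures -/

/-- The potential `V(η) = - log ∫ ϱ(dκ) exp(-κ η² / 2)`. -/
def potential (ϱ : Measure ℝ) (t : ℝ) : ℝ :=
  - Real.log (∫ κ, Real.exp (-(1 / 2) * κ * t ^ 2) ∂ϱ)

/-- Extension of a function on `𝔹(Λ)` by zero to all edges. -/
def extendZero {d : ℕ} {Λ : Finset (Site d)} (ξ : EuclideanSpace ℝ (edgesIn Λ)) : Config d :=
  fun b => if h : b ∈ edgesIn Λ then ξ ⟨b, h⟩ else 0

/-- The linear space of configurations on `𝔹(Λ)` whose extension by zero obeys the loop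
conditions. -/
def loopSpace {d : ℕ} (Λ : Finset (Site d)) :
    Submodule ℝ (EuclideanSpace ℝ (edgesIn Λ)) where
  carrier := {ξ | LoopCondition (extendZero ξ)}
  add_mem' := by
    intro a b ha hb x i j
    have h1 := ha x i j
    have h2 := hb x i j
    have h : ∀ e, extendZero (a + b) e = extendZero a e + extendZero b e := by
      intro e; unfold extendZero; split_ifs <;> simp
    simp only [h]; linarith
  zero_mem' := by
    intro x i j
    have h : ∀ e, extendZero (0 : EuclideanSpace ℝ (edgesIn Λ)) e = 0 := by
      intro e; unfold extendZero; split_ifs <;> simp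
    simp [h]
  smul_mem' := by
    intro c a ha x i j
    have h1 := ha x i j
    have h : ∀ e, extendZero (c • a) e = c * extendZero a e := by
      intro e; unfold extendZero; split_ifs <;> simp
    simp only [h]; linear_combination c * h1

/-- The a priori measure `ν_Λ^{(η)}`: Lebesgue measure on the affine space of all `η'` that agree
with `η` off `𝔹(Λ)` and obey the loop conditions. For an `η` that obeys the loop conditions this
space is the translate by `η` of `loopSpace Λ`. -/
def aPriori {d : ℕ} (Λ : Finset (Site d)) (η : Config d) : Measure (Config d) :=
  Measure.map (fun ξ : loopSpace Λ => η + extendZero (ξ : EuclideanSpace ℝ (edgesIn Λ)))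
    (volume : Measure (loopSpace Λ))

/-- The a priori measure with the Boltzmann weight of the edges touching `Λ`, unnormalized. -/
def gibbsWeight {d : ℕ} (V : ℝ → ℝ) (Λ : Finset (Site d)) (η : Config d) : Measure (Config d) :=
  (aPriori Λ η).withDensity
    fun η' => ENNReal.ofReal (Real.exp (- ∑ b ∈ edgesTouching Λ, V (η' b)))

/-- The specification `γ_Λ(· | η)`; the normalizing constant `Z_Λ(η)` is the total mass of
`gibbsWeight V Λ η`. -/
def gibbsSpec {d : ℕ} (V : ℝ → ℝ) (Λ : Finset (Site d)) (η : Config d) : Measure (Config d) :=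
  (gibbsWeight V Λ η Set.univ)⁻¹ • gibbsWeight V Λ η

/-- The `σ`-algebra generated by the coordinates `η_b`, `b ∉ 𝔹(Λ)`. -/
@[reducible] def sigmaOff {d : ℕ} (Λ : Finset (Site d)) : MeasurableSpace (Config d) :=
  MeasurableSpace.comap (fun (η : Config d) (b : {b : Edge d // b ∉ edgesIn Λ}) => η b)
    inferInstance

/-- `μ` is a gradient Gibbs measure for `V`: it is carried by configurations obeying the loop
conditions, and for each finite `Λ` its regular conditional probability given the gradients off
`𝔹(Λ)` is `γ_Λ`. -/
structure IsGradientGibbs {d : ℕ} (V : ℝ → ℝ) (μ : Measure (Config d)) [IsProbabilityMeasure μ] :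
    Prop where
  loop : ∀ᵐ η ∂μ, LoopCondition η
  gibbs : ∀ Λ : Finset (Site d), ∀ᵐ η ∂μ, condExpKernel μ (sigmaOff Λ) η = gibbsSpec V Λ η

/-- The translation `τ_x`. -/
def shift {d : ℕ} (x : Site d) (η : Config d) : Config d := fun b => η (b.1 + x, b.2)

/-- Translation invariance of a measure on gradient configurations. -/
def IsTranslationInvariant {d : ℕ} (μ : Measure (Config d)) : Prop :=
  ∀ x : Site d, μ.map (shift x) = μ

/-- Ergodicity: every event that is invariant under all translations has measure zero or one. -/
def IsErgodic {d : ℕ} (μ : Measure (Config d)) : Prop :=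
  ∀ A : Set (Config d), MeasurableSet A → (∀ x : Site d, shift x ⁻¹' A = A) → μ A = 0 ∨ μ A = 1

/-- Zero tilt: all gradients are integrable with mean zero. -/
def HasZeroTilt {d : ℕ} (μ : Measure (Config d)) : Prop :=
  ∀ b : Edge d, Integrable (fun η : Config d => η b) μ ∧ ∫ η, η b ∂μ = 0

/-! ### The random linear functional -/

open Classical in
/-- The field `φ` with `φ_0 = 0` whose gradients are `η`. It exists and is unique if `η` obeys the
loop conditions. -/
def height {d : ℕ} (η : Config d) : Site d → ℝ :=
  if h : ∃ φ : Site d → ℝ, φ 0 = 0 ∧ ∀ b : Edge d, η b = φ (Edge.head b) - φ b.1 then h.choose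
  else 0

/-- The Euclidean space `ℝ^d`. -/
abbrev Eucl (d : ℕ) : Type := EuclideanSpace ℝ (Fin d)

/-- The coordinatewise integer part of a point of `ℝ^d`. -/
def floorSite {d : ℕ} (x : Eucl d) : Site d := fun i => ⌊x i⌋

/-- The random variable `φ(f) = ∫ f(x) φ_{⌊x⌋} dx`. -/
def fieldAt {d : ℕ} (f : Eucl d → ℝ) (η : Config d) : ℝ :=
  ∫ x, f x * height η (floorSite x)

/-! ### The space `H₀` with its norm, and its completion -/

/-- The test functions `C_0^∞(ℝ^d)`. -/
structure IsTest {d : ℕ} (g : Eucl d → ℝ) : Prop where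
  smooth : ContDiff ℝ ∞ g
  compact : HasCompactSupport g

theorem two_le_infty : (2 : WithTop ℕ∞) ≤ ∞ := by
  exact WithTop.coe_le_coe.2 (le_top : (2 : ℕ∞) ≤ ⊤)

theorem IsTest.add {d : ℕ} {g h : Eucl d → ℝ} (hg : IsTest g) (hh : IsTest h) :
    IsTest (g + h) := ⟨hg.smooth.add hh.smooth, hg.compact.add hh.compact⟩

theorem IsTest.smul {d : ℕ} {g : Eucl d → ℝ} (c : ℝ) (hg : IsTest g) : IsTest (c • g) :=
  ⟨contDiff_const.smul hg.smooth, hg.compact.smul_left (f := fun _ => c)⟩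

theorem IsTest.two {d : ℕ} {g : Eucl d → ℝ} (hg : IsTest g) (x : Eucl d) : ContDiffAt ℝ 2 g x :=
  (hg.smooth.of_le two_le_infty).contDiffAt

theorem IsTest.differentiable {d : ℕ} {g : Eucl d → ℝ} (hg : IsTest g) : Differentiable ℝ g :=
  hg.smooth.differentiable (by simp)

theorem IsTest.lap_add {d : ℕ} {g h : Eucl d → ℝ} (hg : IsTest g) (hh : IsTest h) :
    Δ (g + h) = Δ g + Δ h := funext fun x => (hg.two x).laplacian_add (hh.two x)

theorem IsTest.lap_smul {d : ℕ} {g : Eucl d → ℝ} (c : ℝ) (hg : IsTest g) :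
    Δ (c • g) = c • Δ g := funext fun x => InnerProductSpace.laplacian_smul c (hg.two x)

theorem IsTest.grad_add {d : ℕ} {g h : Eucl d → ℝ} (hg : IsTest g) (hh : IsTest h) :
    ∇ (g + h) = ∇ g + ∇ h := by
  funext x
  simp only [gradient, Pi.add_apply, fderiv_add (hg.differentiable x) (hh.differentiable x),
    map_add]

theorem IsTest.grad_smul {d : ℕ} {g : Eucl d → ℝ} (c : ℝ) (hg : IsTest g) :
    ∇ (c • g) = c • ∇ g := by
  funext x
  simp [gradient, fderiv_const_smul (hg.differentiable x) c]

theorem IsTest.lap_eq {d : ℕ} (g : Eucl d → ℝ) :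
    Δ g = fun x => ∑ i : Fin d, iteratedFDeriv ℝ 2 g x
      ![EuclideanSpace.basisFun (Fin d) ℝ i, EuclideanSpace.basisFun (Fin d) ℝ i] := by
  rw [InnerProductSpace.laplacian_eq_iteratedFDeriv_orthonormalBasis g
    (EuclideanSpace.basisFun (Fin d) ℝ)]

theorem IsTest.lap_continuous {d : ℕ} {g : Eucl d → ℝ} (hg : IsTest g) : Continuous (Δ g) := by
  rw [IsTest.lap_eq]
  refine continuous_finsetSum _ fun i _ => ?_
  have : Continuous (iteratedFDeriv ℝ 2 g) :=
    hg.smooth.continuous_iteratedFDeriv two_le_infty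
  fun_prop

theorem IsTest.lap_compact {d : ℕ} {g : Eucl d → ℝ} (hg : IsTest g) :
    HasCompactSupport (Δ g) := by
  have h := hg.compact.iteratedFDeriv (𝕜 := ℝ) 2
  rw [IsTest.lap_eq]
  exact h.comp_left (g := fun (m : ContinuousMultilinearMap ℝ (fun _ : Fin 2 => Eucl d) ℝ) =>
    ∑ i : Fin d, m ![EuclideanSpace.basisFun (Fin d) ℝ i, EuclideanSpace.basisFun (Fin d) ℝ i])
    (by simp)

theorem IsTest.grad_continuous {d : ℕ} {g : Eucl d → ℝ} (hg : IsTest g) :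
    Continuous (∇ g) :=
  (InnerProductSpace.toDual ℝ (Eucl d)).symm.continuous.comp
    (hg.smooth.continuous_fderiv (by simp))

theorem IsTest.grad_compact {d : ℕ} {g : Eucl d → ℝ} (hg : IsTest g) :
    HasCompactSupport (∇ g) :=
  (hg.compact.fderiv (𝕜 := ℝ)).comp_left (g := (InnerProductSpace.toDual ℝ (Eucl d)).symm)
    (by simp)

theorem IsTest.integrable_inner {d : ℕ} {g h : Eucl d → ℝ} (hg : IsTest g) (hh : IsTest h) :
    Integrable fun x => inner ℝ (∇ g x) (∇ h x) := by
  refine Continuous.integrable_of_hasCompactSupport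
    (hg.grad_continuous.inner hh.grad_continuous) ?_
  refine hg.grad_compact.mono fun x hx => ?_
  simp only [Function.mem_support] at hx ⊢
  intro h0
  exact hx (by simp [h0])

theorem IsTest.integrable_mul {d : ℕ} {g h : Eucl d → ℝ} (hg : IsTest g) (hh : IsTest h) :
    Integrable fun x => Δ g x * Δ h x :=
  Continuous.integrable_of_hasCompactSupport (hg.lap_continuous.mul hh.lap_continuous)
    (hg.lap_compact.mul_right)

/-- Green's identity for test functions. -/
theorem IsTest.green {d : ℕ} {g h : Eucl d → ℝ} (hg : IsTest g) (hh : IsTest h) :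
    ∫ x, inner ℝ (∇ g x) (∇ h x) = - ∫ x, g x * Δ h x := by
  set e := EuclideanSpace.basisFun (Fin d) ℝ with he
  have hDh : ContDiff ℝ 1 (fderiv ℝ h) := hh.smooth.fderiv_right (by rw [one_add_one_eq_two]; exact two_le_infty)
  have hk : ∀ i, ContDiff ℝ 1 fun y => fderiv ℝ h y (e i) := fun i =>
    hDh.clm_apply contDiff_const
  have hcg : Continuous g := hg.smooth.continuous
  have hdg : ∀ i, Continuous fun y => fderiv ℝ g y (e i) := fun i =>
    (hg.smooth.continuous_fderiv (by simp)).clm_apply continuous_const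
  have hdk : ∀ i, Continuous fun y => fderiv ℝ (fun y => fderiv ℝ h y (e i)) y (e i) := fun i =>
    ((hk i).continuous_fderiv (by simp)).clm_apply continuous_const
  have hdgc : ∀ i, HasCompactSupport fun y => fderiv ℝ g y (e i) := fun i =>
    (hg.compact.fderiv (𝕜 := ℝ)).comp_left (g := fun L : Eucl d →L[ℝ] ℝ => L (e i)) (by simp)
  have i1 : ∀ i, Integrable fun x => fderiv ℝ g x (e i) * fderiv ℝ h x (e i) := fun i =>
    Continuous.integrable_of_hasCompactSupport ((hdg i).mul (hk i).continuous)
      (hdgc i).mul_right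
  have i2 : ∀ i, Integrable fun x =>
      g x * fderiv ℝ (fun y => fderiv ℝ h y (e i)) x (e i) := fun i =>
    Continuous.integrable_of_hasCompactSupport (hcg.mul (hdk i)) hg.compact.mul_right
  have i3 : ∀ i, Integrable fun x => g x * fderiv ℝ h x (e i) := fun i =>
    Continuous.integrable_of_hasCompactSupport (hcg.mul (hk i).continuous) hg.compact.mul_right
  have key : ∀ i, ∫ x, g x * fderiv ℝ (fun y => fderiv ℝ h y (e i)) x (e i)
      = - ∫ x, fderiv ℝ g x (e i) * fderiv ℝ h x (e i) := fun i =>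
    integral_mul_fderiv_eq_neg_fderiv_mul_of_integrable (i1 i) (i2 i) (i3 i)
      (fun x _ => hg.differentiable x) (fun x _ => (hk i).differentiable (by simp) x)
  have hin : ∀ x, inner ℝ (∇ g x) (∇ h x) = ∑ i, fderiv ℝ g x (e i) * fderiv ℝ h x (e i) := by
    intro x
    rw [← e.sum_inner_mul_inner]
    refine Finset.sum_congr rfl fun i _ => ?_
    rw [inner_gradient_left, inner_gradient_right]
    simp
  have hlap : ∀ x, Δ h x = ∑ i, fderiv ℝ (fun y => fderiv ℝ h y (e i)) x (e i) := by
    intro x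
    rw [IsTest.lap_eq]
    refine Finset.sum_congr rfl fun i _ => ?_
    rw [iteratedFDeriv_two_apply,
      fderiv_clm_apply (hDh.differentiable (by simp) x) (differentiableAt_const _)]
    simp [he]
  simp only [hin, hlap, Finset.mul_sum]
  rw [integral_finsetSum _ fun i _ => i1 i, integral_finsetSum _ fun i _ => i2 i,
    ← Finset.sum_neg_distrib]
  refine Finset.sum_congr rfl fun i _ => ?_
  rw [key i, neg_neg]

/-- The gradient of a test function is determined by its Laplacian. -/
theorem IsTest.grad_unique {d : ℕ} {g h : Eucl d → ℝ} (hg : IsTest g) (hh : IsTest h)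
    (hgh : Δ g = Δ h) : ∇ g = ∇ h := by
  have hn : IsTest ((-1 : ℝ) • h) := hh.smul _
  have hw : IsTest (g + (-1 : ℝ) • h) := hg.add hn
  have hl : Δ (g + (-1 : ℝ) • h) = 0 := by
    rw [hg.lap_add hn, hh.lap_smul, hgh]; funext x; simp
  have h0 := hw.green hw
  rw [hl] at h0
  simp only [Pi.zero_apply, mul_zero, integral_zero, neg_zero] at h0
  have hc : Continuous fun x => inner ℝ (∇ (g + (-1 : ℝ) • h) x) (∇ (g + (-1 : ℝ) • h) x) :=
    hw.grad_continuous.inner hw.grad_continuous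
  rw [integral_eq_zero_iff_of_nonneg (fun x => real_inner_self_nonneg)
    (hw.integrable_inner hw)] at h0
  have h1 := (hc.ae_eq_iff_eq volume continuous_zero).1 h0
  have h2 : ∇ (g + (-1 : ℝ) • h) = 0 := funext fun x => by
    have := congrFun h1 x
    simpa using this
  rw [hg.grad_add hn, hh.grad_smul] at h2
  funext x
  have := congrFun h2 x
  simp only [Pi.add_apply, neg_smul, one_smul, Pi.zero_apply] at this
  exact add_neg_eq_zero.1 this

/-- The functions `Δ g` with `g ∈ C_0^∞(ℝ^d)`, as a linear space of functions. -/
def laplacians (d : ℕ) : Submodule ℝ (Eucl d → ℝ) where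
  carrier := {f | ∃ g : Eucl d → ℝ, IsTest g ∧ Δ g = f}
  add_mem' := by
    rintro _ _ ⟨g, hg, rfl⟩ ⟨h, hh, rfl⟩
    exact ⟨g + h, hg.add hh, hg.lap_add hh⟩
  zero_mem' := by
    have hz : IsTest (0 : Eucl d → ℝ) := ⟨contDiff_const, HasCompactSupport.zero⟩
    refine ⟨0, hz, ?_⟩
    have := hz.lap_smul 0
    simpa using this
  smul_mem' := by
    rintro c _ ⟨g, hg, rfl⟩
    exact ⟨c • g, hg.smul c, hg.lap_smul c⟩

/-- The space `H₀ = {Δ g : g ∈ C_0^∞(ℝ^d)}`. This is a separate type (not the subtype itself) so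
that it does not carry the topology of pointwise convergence. -/
def H0 (d : ℕ) : Type := laplacians d

instance instAddCommGroupH0 (d : ℕ) : AddCommGroup (H0 d) :=
  inferInstanceAs (AddCommGroup (laplacians d))

instance instModuleH0 (d : ℕ) : Module ℝ (H0 d) := inferInstanceAs (Module ℝ (laplacians d))

/-- The function `f : ℝ^d → ℝ` underlying an element of `H₀`. -/
def H0.fn {d : ℕ} (f : H0 d) : Eucl d → ℝ := f.1

/-- A test function `g` with `Δ g = f`, that is, `g = Δ⁻¹ f`. -/
def H0.invLap {d : ℕ} (f : H0 d) : Eucl d → ℝ := f.2.choose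

theorem H0.isTest {d : ℕ} (f : H0 d) : IsTest f.invLap := f.2.choose_spec.1

theorem H0.lap_invLap {d : ℕ} (f : H0 d) : Δ f.invLap = f.fn := f.2.choose_spec.2

theorem H0.fn_add {d : ℕ} (f h : H0 d) : (f + h).fn = f.fn + h.fn := rfl

theorem H0.fn_smul {d : ℕ} (c : ℝ) (f : H0 d) : (c • f).fn = c • f.fn := rfl

theorem H0.grad_add {d : ℕ} (f h : H0 d) :
    ∇ (f + h).invLap = ∇ f.invLap + ∇ h.invLap := by
  rw [← f.isTest.grad_add h.isTest]
  refine (f + h).isTest.grad_unique (f.isTest.add h.isTest) ?_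
  rw [f.isTest.lap_add h.isTest, H0.lap_invLap, H0.lap_invLap, H0.lap_invLap, H0.fn_add]

theorem H0.grad_smul {d : ℕ} (c : ℝ) (f : H0 d) : ∇ (c • f).invLap = c • ∇ f.invLap := by
  rw [← f.isTest.grad_smul c]
  refine (c • f).isTest.grad_unique (f.isTest.smul c) ?_
  rw [f.isTest.lap_smul c, H0.lap_invLap, H0.lap_invLap, H0.fn_smul]

theorem H0.integrable_mul {d : ℕ} (f h : H0 d) : Integrable fun x => f.fn x * h.fn x := by
  rw [← f.lap_invLap, ← h.lap_invLap]
  exact f.isTest.integrable_mul h.isTest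

theorem H0.integrable_grad {d : ℕ} (f h : H0 d) :
    Integrable fun x => inner ℝ (∇ f.invLap x) (∇ h.invLap x) :=
  f.isTest.integrable_inner h.isTest

/-- The bilinear form `(f, h) + (f, -Δ⁻¹ h) = ∫ (f h + ∇ Δ⁻¹ f ⋅ ∇ Δ⁻¹ h) dx` on `H₀`. -/
def H0.form {d : ℕ} (f h : H0 d) : ℝ :=
  (∫ x, f.fn x * h.fn x) + ∫ x, inner ℝ (∇ f.invLap x) (∇ h.invLap x)

/-- The form is an inner product. -/
@[reducible] def H0.core (d : ℕ) : InnerProductSpace.Core ℝ (H0 d) where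
  inner f h := H0.form f h
  conj_inner_symm f h := by
    simp only [H0.form, conj_trivial]
    congr 1
    · exact integral_congr_ae (Filter.Eventually.of_forall fun x => mul_comm _ _)
    · exact integral_congr_ae (Filter.Eventually.of_forall fun x => real_inner_comm _ _)
  re_inner_nonneg f := by
    simp only [H0.form, RCLike.re_to_real]
    exact add_nonneg (integral_nonneg fun x => mul_self_nonneg _)
      (integral_nonneg fun x => real_inner_self_nonneg)
  add_left f h k := by
    simp only [H0.form, H0.fn_add, H0.grad_add, Pi.add_apply, add_mul, inner_add_left]
    rw [integral_add (f.integrable_mul k) (h.integrable_mul k),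
      integral_add (f.integrable_grad k) (h.integrable_grad k)]
    ring
  smul_left f h c := by
    simp only [H0.form, H0.fn_smul, H0.grad_smul, Pi.smul_apply, smul_eq_mul, mul_assoc,
      real_inner_smul_left, integral_const_mul, conj_trivial]
    ring
  definite f hf := by
    have h1 : 0 ≤ ∫ x, f.fn x * f.fn x := integral_nonneg fun x => mul_self_nonneg _
    have h2 : 0 ≤ ∫ x, inner ℝ (∇ f.invLap x) (∇ f.invLap x) :=
      integral_nonneg fun x => real_inner_self_nonneg
    have h3 : (∫ x, f.fn x * f.fn x) + ∫ x, inner ℝ (∇ f.invLap x) (∇ f.invLap x) = 0 := hf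
    have h4 : ∫ x, f.fn x * f.fn x = 0 := by linarith
    rw [integral_eq_zero_iff_of_nonneg (fun x => mul_self_nonneg _) (f.integrable_mul f)] at h4
    have hc : Continuous f.fn := by
      rw [← f.lap_invLap]; exact f.isTest.lap_continuous
    have h5 := ((hc.mul hc).ae_eq_iff_eq volume continuous_zero).1 h4
    refine Subtype.ext (funext fun x => ?_)
    exact mul_self_eq_zero.1 (congrFun h5 x)

/-- `H₀` with the norm `‖f‖_H = [(f, f) + (f, -Δ⁻¹ f)]^{1/2}`. -/
instance instNormedAddCommGroupH0 (d : ℕ) : NormedAddCommGroup (H0 d) :=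
  (H0.core d).toNormedAddCommGroup

instance instInnerProductSpaceH0 (d : ℕ) : InnerProductSpace ℝ (H0 d) :=
  InnerProductSpace.ofCore (H0.core d).toCore

/-- The norm of `f = Δ g` is `(∫ (|Δ g|² + |∇ g|²) dx)^{1/2}`, for every test function `g` with
`Δ g = f`. -/
theorem H0.norm_eq {d : ℕ} (f : H0 d) (g : Eucl d → ℝ) (hg : IsTest g) (hgf : Δ g = f.fn) :
    ‖f‖ = √(∫ x, (Δ g x ^ 2 + ‖∇ g x‖ ^ 2)) := by
  have h : ‖f‖ = √(H0.form f f) := rfl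
  have hgr : ∇ f.invLap = ∇ g :=
    f.isTest.grad_unique hg (by rw [f.lap_invLap, hgf])
  have i1 := hg.integrable_mul hg
  have i2 := hg.integrable_inner hg
  simp only [real_inner_self_eq_norm_sq, ← pow_two] at i1 i2
  rw [h, H0.form, hgr, ← hgf, integral_add i1 i2]
  simp only [real_inner_self_eq_norm_sq, ← pow_two]

/-- The Hilbert space `H`, the completion of `H₀`. -/
abbrev H (d : ℕ) : Type := UniformSpace.Completion (H0 d)

end GradientField

end

/-!
Since `e^{-V}` is a mixture of centred Gaussians, the finite-volume Gibbs measure is a mixture of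
Gaussian measures on the loop space, whose couplings lie between `a > 0` and the top of the support
of `ϱ`. For such a Gaussian, `η` is a `κ`-harmonic configuration plus a centred fluctuation, and
the fluctuation part of a linear functional `Σ_b G_b η_b` has variance at most
`a⁻¹ Σ_b G_b²`, uniformly in the volume.

It remains to see that the harmonic part is negligible after averaging over translations in a large
box. Only first moments of `η` are available, so Caccioppoli's inequality is applied with the
heights truncated at a level `t`; it bounds the truncated energy by the first moments of the
gradients and of the heights. As `μ` is ergodic with zero tilt, the mean ergodic theorem in `L¹`
makes the heights sublinear, so on large boxes `t` can be chosen such that both the truncated energy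
and the number of truncated edges are of lower order than the volume. By convexity these first
moments for the harmonic part are bounded by those for `η`.

Finally, by the divergence theorem on unit cells and summation by parts, `φ(Δ g)` is a linear
functional `Σ_b G_b η_b` whose coefficients are fluxes of `∇ g` through faces of cells, and
`Σ_b G_b² ≤ 2 ‖Δ g‖_H²`.
-/

noncomputable section

namespace GradientField

open MeasureTheory ProbabilityTheory Filter
open scoped ContDiff Laplacian Gradient ENNReal Topology

variable {d : ℕ}

/-! ### Heights of gradient configurations -/

/-- The gradient configuration of a field. -/
def grad (φ : Site d → ℝ) : Config d := fun b => φ b.head - φ b.1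

theorem loopCondition_grad (φ : Site d → ℝ) : LoopCondition (grad φ) := by
  intro x i j
  simp only [grad, Edge.head, add_right_comm x (unitVec i) (unitVec j)]
  ring

theorem LoopCondition.add {η ζ : Config d} (hη : LoopCondition η) (hζ : LoopCondition ζ) :
    LoopCondition (η + ζ) := by
  intro x i j
  simp only [Pi.add_apply]
  linarith [hη x i j, hζ x i j]

/-- One step in direction `i` of a walk that records its position together with the sum of the
gradient variables crossed so far. -/
def stepPerm (η : Config d) (i : Fin d) : Equiv.Perm (Site d × ℝ) where
  toFun p := (p.1 + unitVec i, p.2 + η (p.1, i))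
  invFun p := (p.1 - unitVec i, p.2 - η (p.1 - unitVec i, i))
  left_inv p := by simp
  right_inv p := by simp

theorem stepPerm_zpow_fst (η : Config d) (i : Fin d) (k : ℤ) (p : Site d × ℝ) :
    ((stepPerm η i ^ k) p).1 = p.1 + k • unitVec i := by
  induction k using Int.induction_on generalizing p with
  | zero => simp
  | succ k ih =>
    rw [zpow_add_one, Equiv.Perm.mul_apply, ih, add_smul, one_smul]
    simp [stepPerm, add_assoc, add_comm]
  | pred k ih =>
    have hinv : ((stepPerm η i)⁻¹ p).1 = p.1 - unitVec i := rfl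
    rw [zpow_sub_one, Equiv.Perm.mul_apply, ih, sub_smul, one_smul, hinv]
    abel

theorem LoopCondition.commute_stepPerm {η : Config d} (hη : LoopCondition η) (i j : Fin d) :
    Commute (stepPerm η i) (stepPerm η j) := by
  refine Equiv.ext fun p => Prod.ext ?_ ?_
  · simp [stepPerm, add_right_comm]
  · simp only [stepPerm, Equiv.Perm.mul_apply, Equiv.coe_fn_mk]
    linarith [hη p.1 i j]

/-- The action of `ℤ^d`, written multiplicatively, generated by the steps `stepPerm η i`. -/
def LoopCondition.walk {η : Config d} (hη : LoopCondition η) :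
    (Fin d → Multiplicative ℤ) →* Equiv.Perm (Site d × ℝ) :=
  MonoidHom.noncommPiCoprod (fun i => zpowersHom _ (stepPerm η i)) (by
    intro i j _ m n
    rw [zpowersHom_apply, zpowersHom_apply]
    exact (hη.commute_stepPerm i j).zpow_zpow _ _)

theorem LoopCondition.walk_mulSingle {η : Config d} (hη : LoopCondition η) (i : Fin d)
    (m : Multiplicative ℤ) : hη.walk (Pi.mulSingle i m) = stepPerm η i ^ m.toAdd :=
  MonoidHom.noncommPiCoprod_mulSingle (fun i => zpowersHom _ (stepPerm η i)) i m

theorem LoopCondition.walk_fst {η : Config d} (hη : LoopCondition η)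
    (n : Fin d → Multiplicative ℤ) (p : Site d × ℝ) :
    (hη.walk n p).1 = p.1 + fun i => (n i).toAdd := by
  induction n using Pi.mulSingle_induction generalizing p with
  | one => simp [funext_iff]
  | mul m n hm hn =>
    rw [map_mul, Equiv.Perm.mul_apply, hm, hn]
    funext i
    simp [add_comm, add_left_comm]
  | mulSingle i m =>
    rw [walk_mulSingle, stepPerm_zpow_fst]
    congr 1
    funext j
    simp only [unitVec, Pi.smul_apply, Pi.single_apply, Pi.mulSingle_apply, smul_eq_mul]
    split_ifs <;> simp

theorem LoopCondition.exists_eq_grad {η : Config d} (hη : LoopCondition η) :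
    ∃ φ : Site d → ℝ, φ 0 = 0 ∧ η = grad φ := by
  let walkTo (x : Site d) := hη.walk (fun i => Multiplicative.ofAdd (x i))
  have hzero : walkTo 0 = 1 := map_one hη.walk
  have hstep (x : Site d) (i : Fin d) : walkTo (x + unitVec i) = stepPerm η i * walkTo x := by
    have h := hη.walk_mulSingle i (Multiplicative.ofAdd 1)
    rw [toAdd_ofAdd, zpow_one] at h
    rw [← h, ← map_mul]
    congr 1
    funext j
    let e : Fin d → Multiplicative ℤ := Pi.mulSingle i (Multiplicative.ofAdd 1)
    change x j + unitVec i j = (e j).toAdd + x j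
    simp only [add_comm (x j), e, unitVec, Pi.single_apply, Pi.mulSingle_apply]
    split_ifs <;> rfl
  have hfst (x : Site d) : (walkTo x (0, 0)).1 = x := by
    simp [walkTo, hη.walk_fst]
  refine ⟨fun x => (walkTo x (0, 0)).2, by simp [hzero], funext fun ⟨x, i⟩ => ?_⟩
  simp only [grad, Edge.head, hstep, Equiv.Perm.mul_apply]
  simp [stepPerm, hfst]

theorem LoopCondition.height_spec {η : Config d} (hη : LoopCondition η) :
    height η 0 = 0 ∧ grad (height η) = η := by
  obtain ⟨φ, h0, hφ⟩ := hη.exists_eq_grad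
  have hex : ∃ φ : Site d → ℝ, φ 0 = 0 ∧ ∀ b : Edge d, η b = φ b.head - φ b.1 :=
    ⟨φ, h0, congrFun hφ⟩
  rw [height, dif_pos hex]
  exact ⟨hex.choose_spec.1, funext fun b => (hex.choose_spec.2 b).symm⟩

/-- The site with the first `n` coordinates of `z`, the others being zero. These are the corners
of the path from `0` to `z` along the coordinate axes. -/
def truncSite (z : Site d) (n : ℕ) : Site d := fun j => if (j : ℕ) < n then z j else 0

/-- The sum of the gradient variables over the straight path of length `n` from `x` in
direction `i`. -/
def lineSum (x : Site d) (i : Fin d) (n : ℕ) (η : Config d) : ℝ :=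
  ∑ k ∈ Finset.range n, η (x + (k : ℤ) • unitVec i, i)

/-- The sum of the gradient variables along the coordinate path from `0` to `z`; this is a
measurable version of the height at `z`. It is meant for sites with nonnegative coordinates only,
negative ones being truncated. -/
def pathSum (z : Site d) (η : Config d) : ℝ :=
  ∑ i : Fin d, lineSum (truncSite z i) i (z i).toNat η

theorem lineSum_add (x : Site d) (i : Fin d) (n : ℕ) (η ζ : Config d) :
    lineSum x i n (η + ζ) = lineSum x i n η + lineSum x i n ζ := by
  simp [lineSum, Finset.sum_add_distrib]

theorem pathSum_add (z : Site d) (η ζ : Config d) :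
    pathSum z (η + ζ) = pathSum z η + pathSum z ζ := by
  simp [pathSum, lineSum_add, Finset.sum_add_distrib]

@[fun_prop]
theorem measurable_lineSum (x : Site d) (i : Fin d) (n : ℕ) : Measurable (lineSum x i n) := by
  unfold lineSum
  fun_prop

@[fun_prop]
theorem measurable_pathSum (z : Site d) : Measurable (pathSum z) :=
  Finset.measurable_fun_sum _ fun _ _ => measurable_lineSum _ _ _

theorem lineSum_grad (x : Site d) (i : Fin d) (n : ℕ) (φ : Site d → ℝ) :
    lineSum x i n (grad φ) = φ (x + (n : ℤ) • unitVec i) - φ x := by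
  have h := Finset.sum_range_sub (fun k : ℕ => φ (x + (k : ℤ) • unitVec i)) n
  simp only [Nat.cast_zero, zero_smul, add_zero] at h
  rw [← h]
  refine Finset.sum_congr rfl fun k _ => ?_
  simp only [grad, Edge.head, Nat.cast_succ, add_smul, one_smul, add_assoc]

theorem truncSite_add_smul_unitVec {z : Site d} (hz : 0 ≤ z) (i : Fin d) :
    truncSite z i + ((z i).toNat : ℤ) • unitVec i = truncSite z (i + 1) := by
  funext j
  simp only [truncSite, unitVec, Int.toNat_of_nonneg (hz i), Pi.add_apply, Pi.smul_apply,
    Pi.single_apply, smul_eq_mul]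
  rcases lt_trichotomy j i with hj | rfl | hj
  · have hij : (j : ℕ) < i := hj
    simp [hij, hj.ne, Nat.lt_succ_of_lt hij]
  · simp
  · have hij : (i : ℕ) < j := hj
    simp [hij.not_gt, hj.ne', show ¬ (j : ℕ) < (i : ℕ) + 1 by lia]

theorem pathSum_grad {z : Site d} (hz : 0 ≤ z) (φ : Site d → ℝ) :
    pathSum z (grad φ) = φ z - φ 0 := by
  have htop : truncSite z d = z := by funext j; simp [truncSite]
  have hbot : truncSite z 0 = 0 := by funext j; simp [truncSite]
  calc pathSum z (grad φ)
      = ∑ i : Fin d, (φ (truncSite z (i + 1)) - φ (truncSite z i)) :=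
        Finset.sum_congr rfl fun i _ => by rw [lineSum_grad, truncSite_add_smul_unitVec hz]
    _ = φ z - φ 0 := by
        rw [Fin.sum_univ_eq_sum_range (fun n => φ (truncSite z (n + 1)) - φ (truncSite z n)),
          Finset.sum_range_sub (fun n => φ (truncSite z n)), htop, hbot]

theorem LoopCondition.pathSum_eq_height {η : Config d} (hη : LoopCondition η) {z : Site d}
    (hz : 0 ≤ z) : pathSum z η = height η z := by
  conv_lhs => rw [← hη.height_spec.2]
  rw [pathSum_grad hz, hη.height_spec.1, sub_zero]

/-! ### Gaussian weights on finite-dimensional spaces -/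

/-- The unnormalized density `exp (-Q(x, x) / 2)` of the centred Gaussian law with inverse
covariance `Q`, as an extended nonnegative real. -/
def gaussWeight {E : Type*} [AddCommGroup E] [Module ℝ E] (Q : LinearMap.BilinForm ℝ E) (x : E) :
    ℝ≥0∞ :=
  ENNReal.ofReal (Real.exp (-(Q x x) / 2))

section Form

variable {E : Type*} [AddCommGroup E] [Module ℝ E]

theorem gaussWeight_neg (Q : LinearMap.BilinForm ℝ E) (x : E) :
    gaussWeight Q (-x) = gaussWeight Q x := by
  simp [gaussWeight]

theorem exp_mul_gaussWeight {Q : LinearMap.BilinForm ℝ E} (hsymm : ∀ x y, Q x y = Q y x)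
    (g x : E) :
    ENNReal.ofReal (Real.exp (Q g x)) * gaussWeight Q x =
      ENNReal.ofReal (Real.exp (Q g g / 2)) * gaussWeight Q (x - g) := by
  simp only [gaussWeight]
  rw [← ENNReal.ofReal_mul (Real.exp_pos _).le, ← ENNReal.ofReal_mul (Real.exp_pos _).le,
    ← Real.exp_add, ← Real.exp_add]
  congr 2
  simp only [map_sub, LinearMap.sub_apply, hsymm x g]
  ring

variable [FiniteDimensional ℝ E]

theorem exists_riesz {Q : LinearMap.BilinForm ℝ E} (hpos : ∀ x, Q x x = 0 → x = 0)
    (l : E →ₗ[ℝ] ℝ) : ∃ g, Q g = l := by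
  have hinj : Function.Injective Q :=
    (injective_iff_map_eq_zero Q).2 fun x hx => hpos x (by rw [hx, LinearMap.zero_apply])
  exact (LinearMap.injective_iff_surjective_of_finrank_eq_finrank
    (Subspace.dual_finrank_eq (K := ℝ) (V := E)).symm).1 hinj l

theorem exists_riesz_of_sq_le {Q : LinearMap.BilinForm ℝ E} (hpos : ∀ x, Q x x = 0 → x = 0)
    {l : E →ₗ[ℝ] ℝ} {s : ℝ} (hs : 0 < s) (hl : ∀ x, l x ^ 2 ≤ s * Q x x) :
    ∃ g, Q g g ≤ 1 ∧ ∀ x, l x ^ 2 = s * Q g x ^ 2 := by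
  obtain ⟨g, hg⟩ := exists_riesz hpos ((√s)⁻¹ • l)
  have hlg (x : E) : l x ^ 2 = s * Q g x ^ 2 := by
    rw [hg, LinearMap.smul_apply, smul_eq_mul, mul_pow, inv_pow, Real.sq_sqrt hs.le,
      mul_inv_cancel_left₀ hs.ne']
  have hQ : Q g g ^ 2 ≤ Q g g := le_of_mul_le_mul_left ((hlg g).symm.trans_le (hl g)) hs
  exact ⟨g, by nlinarith, hlg⟩

end Form

theorem sq_le_two_mul_exp_add_exp (x : ℝ) : x ^ 2 ≤ 2 * (Real.exp x + Real.exp (-x)) := by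
  have h1 := Real.exp_pos x
  have h2 := Real.exp_pos (-x)
  rcases le_total 0 x with h | h
  · linarith [Real.quadratic_le_exp_of_nonneg h]
  · linarith [Real.quadratic_le_exp_of_nonneg (neg_nonneg.2 h), neg_sq x]

theorem exp_half_le_two : Real.exp (1 / 2) ≤ 2 := by
  have h : 1 / 2 ≤ Real.exp (-(1 / 2)) := by linarith [Real.add_one_le_exp (-(1 / 2) : ℝ)]
  rw [Real.exp_neg] at h
  simpa using inv_anti₀ (by norm_num) h

section GaussianWeight

variable {E : Type*} [NormedAddCommGroup E] [NormedSpace ℝ E] [MeasurableSpace E] [BorelSpace E]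
  {ν : Measure E}

theorem lintegral_exp_mul_gaussWeight [ν.IsAddRightInvariant] {Q : LinearMap.BilinForm ℝ E}
    (hsymm : ∀ x y, Q x y = Q y x) (g : E) :
    ∫⁻ x, ENNReal.ofReal (Real.exp (Q g x)) * gaussWeight Q x ∂ν
      = ENNReal.ofReal (Real.exp (Q g g / 2)) * ∫⁻ x, gaussWeight Q x ∂ν := by
  simp only [exp_mul_gaussWeight hsymm]
  rw [lintegral_const_mul' _ _ ENNReal.ofReal_ne_top, lintegral_sub_right_eq_self]

variable [FiniteDimensional ℝ E]

theorem measurable_gaussWeight (Q : LinearMap.BilinForm ℝ E) : Measurable (gaussWeight Q) := by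
  have hQ : Continuous fun x => Q x x :=
    (LinearMap.toContinuousLinearMap.toLinearMap ∘ₗ Q).continuous_of_finiteDimensional.clm_apply
      continuous_id
  exact ENNReal.measurable_ofReal.comp (Real.measurable_exp.comp (hQ.measurable.neg.div_const 2))

theorem measurable_exp_mul_gaussWeight (Q : LinearMap.BilinForm ℝ E) (g : E) :
    Measurable fun x => ENNReal.ofReal (Real.exp (Q g x)) * gaussWeight Q x := by
  have h : Continuous (Q g) := (Q g).continuous_of_finiteDimensional
  exact (h.rexp.measurable.ennreal_ofReal).mul (measurable_gaussWeight Q)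

theorem lintegral_sq_mul_gaussWeight_le [ν.IsAddRightInvariant] {Q : LinearMap.BilinForm ℝ E}
    (hsymm : ∀ x y, Q x y = Q y x) (hpos : ∀ x, Q x x = 0 → x = 0) {l : E →ₗ[ℝ] ℝ} {s : ℝ}
    (hs : 0 < s) (hl : ∀ x, l x ^ 2 ≤ s * Q x x) :
    ∫⁻ x, ENNReal.ofReal (l x ^ 2) * gaussWeight Q x ∂ν
      ≤ ENNReal.ofReal (8 * s) * ∫⁻ x, gaussWeight Q x ∂ν := by
  obtain ⟨g, hgg, hlg⟩ := exists_riesz_of_sq_le hpos hs hl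
  let w (h x : E) := ENNReal.ofReal (Real.exp (Q h x)) * gaussWeight Q x
  have hpt (x : E) :
      ENNReal.ofReal (l x ^ 2) * gaussWeight Q x ≤ ENNReal.ofReal (2 * s) * (w g x + w (-g) x) := by
    rw [← add_mul, ← mul_assoc, ← ENNReal.ofReal_add (Real.exp_pos _).le (Real.exp_pos _).le,
      ← ENNReal.ofReal_mul (by positivity), hlg, map_neg, LinearMap.neg_apply, mul_comm 2 s,
      mul_assoc]
    gcongr
    exact sq_le_two_mul_exp_add_exp _
  have hexp : Real.exp (Q g g / 2) ≤ 2 :=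
    (Real.exp_le_exp.2 (by linarith)).trans exp_half_le_two
  have hw (h : E) (hh : Q h h = Q g g) :
      ∫⁻ x, w h x ∂ν ≤ ENNReal.ofReal 2 * ∫⁻ x, gaussWeight Q x ∂ν := by
    rw [lintegral_exp_mul_gaussWeight hsymm, hh]
    gcongr
  calc ∫⁻ x, ENNReal.ofReal (l x ^ 2) * gaussWeight Q x ∂ν
      ≤ ENNReal.ofReal (2 * s) * (∫⁻ x, w g x ∂ν + ∫⁻ x, w (-g) x ∂ν) := by
        rw [← lintegral_add_left (measurable_exp_mul_gaussWeight Q g),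
          ← lintegral_const_mul' _ _ ENNReal.ofReal_ne_top]
        exact lintegral_mono hpt
    _ ≤ ENNReal.ofReal (2 * s) * (ENNReal.ofReal 2 * (∫⁻ x, gaussWeight Q x ∂ν) +
        ENNReal.ofReal 2 * ∫⁻ x, gaussWeight Q x ∂ν) := by
        gcongr
        · exact hw g rfl
        · exact hw (-g) (by simp)
    _ = ENNReal.ofReal (8 * s) * ∫⁻ x, gaussWeight Q x ∂ν := by
        rw [← add_mul, ← mul_assoc, ← ENNReal.ofReal_add (by norm_num) (by norm_num),
          ← ENNReal.ofReal_mul (by positivity)]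
        ring_nf

theorem mul_lintegral_gaussWeight_le [ν.IsAddHaarMeasure] (Q : LinearMap.BilinForm ℝ E)
    {f : E → ℝ≥0∞} (hf : Measurable f) {c : ℝ≥0∞} (hc : ∀ x, 2 * c ≤ f x + f (-x)) :
    c * ∫⁻ x, gaussWeight Q x ∂ν ≤ ∫⁻ x, f x * gaussWeight Q x ∂ν := by
  have hmeas : Measurable fun x => f x * gaussWeight Q x := hf.mul (measurable_gaussWeight Q)
  have hrefl : ∫⁻ x, f (-x) * gaussWeight Q x ∂ν = ∫⁻ x, f x * gaussWeight Q x ∂ν := by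
    rw [← lintegral_neg_eq_self]
    simp only [gaussWeight_neg, neg_neg]
  refine (ENNReal.mul_le_mul_iff_right two_ne_zero ENNReal.ofNat_ne_top).1 ?_
  calc 2 * (c * ∫⁻ x, gaussWeight Q x ∂ν)
      = ∫⁻ x, 2 * c * gaussWeight Q x ∂ν := by
        rw [lintegral_const_mul _ (measurable_gaussWeight Q), mul_assoc]
    _ ≤ ∫⁻ x, (f x * gaussWeight Q x + f (-x) * gaussWeight Q x) ∂ν := by
        refine lintegral_mono fun x => ?_
        rw [← add_mul]
        gcongr
        exact hc x
    _ = 2 * ∫⁻ x, f x * gaussWeight Q x ∂ν := by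
        rw [lintegral_add_left hmeas, hrefl, two_mul]

end GaussianWeight

/-! ### A truncated energy estimate for harmonic fields -/

/-- Truncation of a real number to the interval `[-t, t]`, for `0 ≤ t`. -/
def clip (t u : ℝ) : ℝ := max (-t) (min u t)

theorem abs_clip_le {t : ℝ} (ht : 0 ≤ t) (u : ℝ) : |clip t u| ≤ t :=
  abs_le.2 ⟨le_max_left _ _, max_le (by linarith) (min_le_right _ _)⟩

theorem clip_of_abs_le {t u : ℝ} (h : |u| ≤ t) : clip t u = u := by
  rw [clip, min_eq_left (abs_le.1 h).2, max_eq_right (abs_le.1 h).1]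

theorem monotone_clip (t : ℝ) : Monotone (clip t) := fun _ _ h =>
  max_le_max le_rfl (min_le_min h le_rfl)

theorem abs_clip_sub_clip_le (t u v : ℝ) : |clip t u - clip t v| ≤ |u - v| := by
  unfold clip
  refine (abs_max_sub_max_le_max _ _ _ _).trans ?_
  rw [sub_self, abs_zero]
  refine max_le (abs_nonneg _) ((abs_min_sub_min_le_max _ _ _ _).trans ?_)
  rw [sub_self, abs_zero]
  exact max_le le_rfl (abs_nonneg _)

theorem clip_sub_clip_sq_le (t u v : ℝ) :
    (clip t u - clip t v) ^ 2 ≤ (u - v) * (clip t u - clip t v) := by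
  have h := abs_clip_sub_clip_le t u v
  rcases le_total u v with huv | huv
  · have := monotone_clip t huv
    rw [abs_of_nonpos (by linarith), abs_of_nonpos (by linarith)] at h
    nlinarith
  · have := monotone_clip t huv
    rw [abs_of_nonneg (by linarith), abs_of_nonneg (by linarith)] at h
    nlinarith

section EnergyEstimate

variable {T : Finset (Edge d)} {κ : Edge d → ℝ} {a A δ t m : ℝ} {ψ ξ : Site d → ℝ}

theorem grad_mul (ξ χ : Site d → ℝ) (b : Edge d) :
    grad (fun x => ξ x * χ x) b = ξ b.head * grad χ b + grad ξ b * χ b.1 := by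
  simp only [grad]
  ring

theorem mul_grad_clip_sq_le {k : ℝ} (hk : a ≤ k ∧ k ≤ A) (ha : 0 < a) (ht : 0 ≤ t)
    (hξ : ∀ x, 0 ≤ ξ x) {b : Edge d} (hδ : |grad ξ b| ≤ δ) :
    a * (ξ b.head * grad (clip t ∘ ψ) b ^ 2) ≤
      k * grad ψ b * grad (fun x => ξ x * clip t (ψ x)) b + A * δ * t * |grad ψ b| := by
  have hk0 : 0 < k := ha.trans_le hk.1
  have hmain : a * (ξ b.head * grad (clip t ∘ ψ) b ^ 2) ≤
      k * (ξ b.head * (grad ψ b * grad (clip t ∘ ψ) b)) := by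
    have h0 := hξ b.head
    have h1 := hk.1
    gcongr
    exact clip_sub_clip_sq_le t (ψ b.head) (ψ b.1)
  have hcutoff : |k * (grad ψ b * (grad ξ b * clip t (ψ b.1)))| ≤ A * δ * t * |grad ψ b| := by
    have hA : 0 ≤ A := hk0.le.trans hk.2
    have hδ0 : 0 ≤ δ := (abs_nonneg _).trans hδ
    calc |k * (grad ψ b * (grad ξ b * clip t (ψ b.1)))|
        = k * (|grad ψ b| * (|grad ξ b| * |clip t (ψ b.1)|)) := by
          rw [abs_mul, abs_mul, abs_mul, abs_of_pos hk0]
      _ ≤ A * (|grad ψ b| * (δ * t)) := by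
          gcongr
          · exact hk.2
          · exact abs_clip_le ht _
      _ = A * δ * t * |grad ψ b| := by ring
  have hprod : k * grad ψ b * grad (fun x => ξ x * clip t (ψ x)) b
      = k * (ξ b.head * (grad ψ b * grad (clip t ∘ ψ) b))
        + k * (grad ψ b * (grad ξ b * clip t (ψ b.1))) := by
    rw [grad_mul]
    simp only [Function.comp_def]
    ring
  linarith [neg_abs_le (k * (grad ψ b * (grad ξ b * clip t (ψ b.1))))]

/-- The Caccioppoli inequality for a field that is only controlled in `L¹`: testing harmonicity
against `ξ · clip t ψ` instead of `ξ² ψ` makes the cutoff error linear in `grad ψ`. -/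
theorem truncated_energy_le (hκ : ∀ b ∈ T, a ≤ κ b ∧ κ b ≤ A) (ha : 0 < a) (ht : 0 ≤ t)
    (hξ : ∀ x, 0 ≤ ξ x) (hδ : ∀ b, |grad ξ b| ≤ δ)
    (hharm : ∑ b ∈ T, κ b * grad ψ b * grad (fun x => ξ x * clip t (ψ x)) b = 0) :
    ∑ b ∈ T, ξ b.head * grad (clip t ∘ ψ) b ^ 2 ≤ A * δ * t / a * ∑ b ∈ T, |grad ψ b| := by
  have h := Finset.sum_le_sum fun b hb => mul_grad_clip_sq_le (ψ := ψ) (hκ b hb) ha ht hξ (hδ b)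
  rw [← Finset.mul_sum, Finset.sum_add_distrib, hharm, zero_add, ← Finset.mul_sum] at h
  rwa [div_mul_eq_mul_div, le_div_iff₀ ha, mul_comm _ a]

/-- The linear functional `Σ_{b ∈ S} G_b η_b`. -/
def pairing (S : Finset (Edge d)) (G : Edge d → ℝ) (η : Config d) : ℝ :=
  ∑ b ∈ S, G b * η b

theorem pairing_add (S : Finset (Edge d)) (G : Edge d → ℝ) (η ζ : Config d) :
    pairing S G (η + ζ) = pairing S G η + pairing S G ζ := by
  simp [pairing, mul_add, Finset.sum_add_distrib]

@[fun_prop]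
theorem measurable_pairing (S : Finset (Edge d)) (G : Edge d → ℝ) :
    Measurable (pairing S G) := by
  unfold pairing
  fun_prop

theorem pairing_sq_le (S : Finset (Edge d)) (G : Edge d → ℝ) (η : Config d) :
    pairing S G η ^ 2 ≤ (∑ b ∈ S, G b ^ 2) * ∑ b ∈ S, η b ^ 2 :=
  Finset.sum_mul_sq_le_sq_mul_sq _ _ _

theorem min_pairing_grad_sq_le (S : Finset (Edge d)) (G : Edge d → ℝ) (ψ : Site d → ℝ)
    (ht : 0 < t) (hm : 0 ≤ m) :
    min (pairing S G (grad ψ) ^ 2) m ≤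
      (∑ b ∈ S, G b ^ 2) * (∑ b ∈ S, grad (clip t ∘ ψ) b ^ 2)
        + m / t * ∑ b ∈ S, (|ψ b.1| + |ψ b.head|) := by
  by_cases hsmall : ∀ b ∈ S, |ψ b.1| ≤ t ∧ |ψ b.head| ≤ t
  · have hclip : pairing S G (grad ψ) = pairing S G (grad (clip t ∘ ψ)) := by
      refine Finset.sum_congr rfl fun b hb => ?_
      simp only [grad, Function.comp_apply, clip_of_abs_le (hsmall b hb).1,
        clip_of_abs_le (hsmall b hb).2]
    rw [hclip]
    exact (min_le_left _ _).trans ((pairing_sq_le _ _ _).trans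
      (le_add_of_nonneg_right (by positivity)))
  · push Not at hsmall
    obtain ⟨b, hb, hbt⟩ := hsmall
    have hlarge : t ≤ |ψ b.1| + |ψ b.head| := by
      by_cases hb1 : |ψ b.1| ≤ t
      · linarith [hbt hb1, abs_nonneg (ψ b.1)]
      · linarith [abs_nonneg (ψ b.head)]
    have hsum : t ≤ ∑ b ∈ S, (|ψ b.1| + |ψ b.head|) :=
      hlarge.trans (Finset.single_le_sum (f := fun b : Edge d => |ψ b.1| + |ψ b.head|)
        (fun b _ => by positivity) hb)
    have hm' : m ≤ m / t * ∑ b ∈ S, (|ψ b.1| + |ψ b.head|) := by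
      rw [div_mul_eq_mul_div, le_div_iff₀ ht]
      exact mul_le_mul_of_nonneg_left hsum hm
    exact (min_le_right _ _).trans (hm'.trans (le_add_of_nonneg_left (by positivity)))

/-- The translate `b + x` of an edge, for which `shift x η b = η (b.translate x)`. -/
def Edge.translate (x : Site d) (b : Edge d) : Edge d := (b.1 + x, b.2)

theorem Edge.head_translate (x : Site d) (b : Edge d) : (b.translate x).head = b.head + x := by
  simp [Edge.translate, Edge.head, add_right_comm]

theorem shift_grad (x : Site d) (ψ : Site d → ℝ) :
    shift x (grad ψ) = grad fun y => ψ (y + x) := by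
  funext b
  change grad ψ (b.translate x) = _
  rw [grad, Edge.head_translate]
  rfl

@[fun_prop]
theorem measurable_shift (x : Site d) : Measurable (shift x) :=
  measurable_pi_lambda _ fun b => measurable_pi_apply (b.translate x)

theorem Edge.translate_injective (x : Site d) : Function.Injective (Edge.translate x) :=
  fun _ _ h => Prod.ext (add_right_cancel (Prod.mk.inj h).1) (Prod.mk.inj h).2

theorem sum_sum_translate_le {B : Finset (Site d)} {S : Finset (Edge d)} {F : Edge d → ℝ}
    (hF : ∀ b ∈ T, 0 ≤ F b) (h : ∀ x ∈ B, ∀ b ∈ S, b.translate x ∈ T) :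
    ∑ x ∈ B, ∑ b ∈ S, F (b.translate x) ≤ S.card * ∑ b ∈ T, F b := by
  rw [Finset.sum_comm, ← nsmul_eq_mul]
  refine Finset.sum_le_card_nsmul _ _ _ fun b hb => ?_
  have hinj : Set.InjOn (fun x => b.translate x) (B : Set (Site d)) := fun x _ y _ hxy =>
    add_left_cancel (congrArg Prod.fst hxy)
  rw [← Finset.sum_image (f := F) hinj]
  refine Finset.sum_le_sum_of_subset_of_nonneg (fun c hc => ?_) fun b hb _ => hF b hb
  obtain ⟨x, hx, rfl⟩ := Finset.mem_image.1 hc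
  exact h x hx b hb

theorem sum_min_pairing_shift_le {B : Finset (Site d)} {S : Finset (Edge d)}
    (hκ : ∀ b ∈ T, a ≤ κ b ∧ κ b ≤ A) (ha : 0 < a) (ht : 0 < t) (hm : 0 ≤ m) (G : Edge d → ℝ)
    (hξ : ∀ x, 0 ≤ ξ x) (hδ : ∀ b, |grad ξ b| ≤ δ)
    (hB : ∀ x ∈ B, ∀ b ∈ S, b.translate x ∈ T ∧ ξ (b.head + x) = 1)
    (hharm : ∑ b ∈ T, κ b * grad ψ b * grad (fun x => ξ x * clip t (ψ x)) b = 0) :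
    ∑ x ∈ B, min (pairing S G (shift x (grad ψ)) ^ 2) m ≤
      (∑ b ∈ S, G b ^ 2) * (S.card * (A * δ * t / a)) * (∑ b ∈ T, |grad ψ b|)
        + m / t * ∑ x ∈ B, ∑ b ∈ S, (|ψ (b.1 + x)| + |ψ (b.head + x)|) := by
  let F (b : Edge d) : ℝ := ξ b.head * grad (clip t ∘ ψ) b ^ 2
  have hshift : ∀ x ∈ B, min (pairing S G (shift x (grad ψ)) ^ 2) m ≤
      (∑ b ∈ S, G b ^ 2) * (∑ b ∈ S, F (b.translate x))
        + m / t * ∑ b ∈ S, (|ψ (b.1 + x)| + |ψ (b.head + x)|) := by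
    intro x hx
    rw [shift_grad]
    refine (min_pairing_grad_sq_le S G _ ht hm).trans_eq ?_
    congr 2
    refine Finset.sum_congr rfl fun b hb => ?_
    simp only [F, Edge.head_translate, (hB x hx b hb).2, one_mul]
    exact congrArg (· ^ 2) (congrFun (shift_grad x (clip t ∘ ψ)) b).symm
  have henergy : ∑ x ∈ B, ∑ b ∈ S, F (b.translate x) ≤
      S.card * (A * δ * t / a * ∑ b ∈ T, |grad ψ b|) :=
    (sum_sum_translate_le (fun b _ => mul_nonneg (hξ _) (sq_nonneg _))
      fun x hx b hb => (hB x hx b hb).1).trans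
      (by gcongr; exact truncated_energy_le hκ ha ht.le hξ hδ hharm)
  refine (Finset.sum_le_sum hshift).trans ?_
  rw [Finset.sum_add_distrib, ← Finset.mul_sum, ← Finset.mul_sum, mul_assoc, mul_assoc]
  gcongr

end EnergyEstimate

/-! ### The finite-volume estimate for Gaussian couplings -/

/-- Extension by zero, as a linear map on the loop space. -/
def loopExtend (Λ : Finset (Site d)) : loopSpace Λ →ₗ[ℝ] Config d where
  toFun ζ := extendZero (ζ : EuclideanSpace ℝ (edgesIn Λ))
  map_add' ζ χ := by
    funext b
    simp only [extendZero, Pi.add_apply]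
    split_ifs <;> simp
  map_smul' c ζ := by
    funext b
    simp only [extendZero, Pi.smul_apply]
    split_ifs <;> simp

theorem mem_edgesIn {Λ : Finset (Site d)} {b : Edge d} :
    b ∈ edgesIn Λ ↔ b.1 ∈ Λ ∧ b.head ∈ Λ := by
  simp [edgesIn]

theorem edgesIn_subset_edgesTouching (Λ : Finset (Site d)) : edgesIn Λ ⊆ edgesTouching Λ :=
  fun _ hb => Finset.mem_union_left _ (Finset.filter_subset _ _ hb)

section LoopExtend

variable {Λ : Finset (Site d)}

theorem loopCondition_loopExtend (ζ : loopSpace Λ) : LoopCondition (loopExtend Λ ζ) := ζ.2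

theorem loopExtend_apply_mem (ζ : loopSpace Λ) {b : Edge d} (hb : b ∈ edgesIn Λ) :
    loopExtend Λ ζ b = (ζ : EuclideanSpace ℝ (edgesIn Λ)) ⟨b, hb⟩ := by
  change extendZero _ b = _
  rw [extendZero, dif_pos hb]

@[fun_prop]
theorem measurable_loopExtend (Λ : Finset (Site d)) : Measurable (loopExtend Λ) :=
  measurable_pi_lambda _ fun b =>
    ((LinearMap.proj b ∘ₗ loopExtend Λ).continuous_of_finiteDimensional).measurable

theorem exists_loopExtend_eq_grad {v : Site d → ℝ}
    (hv : ∀ b : Edge d, b ∉ edgesIn Λ → v b.1 = 0 ∧ v b.head = 0) :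
    ∃ ζ : loopSpace Λ, loopExtend Λ ζ = grad v := by
  have h : extendZero (Λ := Λ) (WithLp.toLp 2 fun b => grad v b) = grad v := by
    funext b
    rw [extendZero]
    split_ifs with hb
    · rfl
    · simp [grad, hv b hb]
  refine ⟨⟨WithLp.toLp 2 fun b => grad v b, ?_⟩, h⟩
  change LoopCondition _
  rw [h]
  exact loopCondition_grad v

end LoopExtend

/-- The quadratic form `Σ_b κ_b ζ_b χ_b` on the loop space. -/
def energyForm (Λ : Finset (Site d)) (κ : Edge d → ℝ) : LinearMap.BilinForm ℝ (loopSpace Λ) :=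
  ∑ b ∈ edgesTouching Λ, κ b •
    LinearMap.BilinForm.linMulLin (LinearMap.proj b ∘ₗ loopExtend Λ)
      (LinearMap.proj b ∘ₗ loopExtend Λ)

/-- A configuration is harmonic in `Λ` for the couplings `κ` if it is orthogonal, with respect to
`κ`, to all fluctuations inside `Λ`. -/
def IsHarmonic (Λ : Finset (Site d)) (κ : Edge d → ℝ) (h : Config d) : Prop :=
  ∀ ζ : loopSpace Λ, ∑ b ∈ edgesTouching Λ, κ b * h b * loopExtend Λ ζ b = 0

/-- The Gaussian Boltzmann factor with couplings `κ` on the edges of `T`. -/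
def gaussFactor (T : Finset (Edge d)) (κ : Edge d → ℝ) (η : Config d) : ℝ≥0∞ :=
  ENNReal.ofReal (Real.exp (-(1 / 2) * ∑ b ∈ T, κ b * η b ^ 2))

section EnergyForm

variable {Λ : Finset (Site d)} {κ : Edge d → ℝ} {a : ℝ}

theorem energyForm_apply (Λ : Finset (Site d)) (κ : Edge d → ℝ) (ζ χ : loopSpace Λ) :
    energyForm Λ κ ζ χ = ∑ b ∈ edgesTouching Λ, κ b * loopExtend Λ ζ b * loopExtend Λ χ b := by
  simp [energyForm, LinearMap.sum_apply, mul_assoc]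

theorem energyForm_symm (Λ : Finset (Site d)) (κ : Edge d → ℝ) (ζ χ : loopSpace Λ) :
    energyForm Λ κ ζ χ = energyForm Λ κ χ ζ := by
  simp only [energyForm_apply, mul_right_comm]

theorem le_energyForm (hκ : ∀ b ∈ edgesTouching Λ, a ≤ κ b) (ζ : loopSpace Λ) :
    a * ∑ b ∈ edgesTouching Λ, loopExtend Λ ζ b ^ 2 ≤ energyForm Λ κ ζ ζ := by
  rw [energyForm_apply, Finset.mul_sum]
  refine Finset.sum_le_sum fun b hb => ?_
  rw [mul_assoc, ← pow_two]
  exact mul_le_mul_of_nonneg_right (hκ b hb) (sq_nonneg _)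

theorem eq_zero_of_energyForm_eq_zero (ha : 0 < a) (hκ : ∀ b ∈ edgesTouching Λ, a ≤ κ b)
    (ζ : loopSpace Λ) (h : energyForm Λ κ ζ ζ = 0) : ζ = 0 := by
  have hle : a * ∑ b ∈ edgesTouching Λ, loopExtend Λ ζ b ^ 2 ≤ 0 := h ▸ le_energyForm hκ ζ
  have hsum : ∑ b ∈ edgesTouching Λ, loopExtend Λ ζ b ^ 2 = 0 :=
    le_antisymm (nonpos_of_mul_nonpos_right hle ha) (by positivity)
  rw [Finset.sum_eq_zero_iff_of_nonneg fun b _ => sq_nonneg _] at hsum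
  refine Subtype.ext (PiLp.ext fun b => ?_)
  have hb := pow_eq_zero_iff two_ne_zero |>.1 (hsum b (edgesIn_subset_edgesTouching Λ b.2))
  rwa [loopExtend_apply_mem ζ b.2] at hb

theorem exists_isHarmonic_add_loopExtend (ha : 0 < a) (hκ : ∀ b ∈ edgesTouching Λ, a ≤ κ b)
    (η : Config d) : ∃ ζ : loopSpace Λ, IsHarmonic Λ κ (η + loopExtend Λ ζ) := by
  let l : loopSpace Λ →ₗ[ℝ] ℝ :=
    ∑ b ∈ edgesTouching Λ, (κ b * η b) • (LinearMap.proj b ∘ₗ loopExtend Λ)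
  obtain ⟨ζ, hζ⟩ := exists_riesz (eq_zero_of_energyForm_eq_zero ha hκ) (-l)
  refine ⟨ζ, fun χ => ?_⟩
  have h : energyForm Λ κ ζ χ = -l χ := LinearMap.congr_fun hζ χ
  rw [energyForm_apply] at h
  simp only [Pi.add_apply, mul_add, add_mul, Finset.sum_add_distrib, h]
  simp [l, LinearMap.sum_apply]

theorem IsHarmonic.gaussFactor_add_loopExtend {h : Config d} (hh : IsHarmonic Λ κ h)
    (ζ : loopSpace Λ) :
    gaussFactor (edgesTouching Λ) κ (h + loopExtend Λ ζ)
      = gaussFactor (edgesTouching Λ) κ h * gaussWeight (energyForm Λ κ) ζ := by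
  have hsq : ∑ b ∈ edgesTouching Λ, κ b * (h + loopExtend Λ ζ) b ^ 2
      = ∑ b ∈ edgesTouching Λ, κ b * h b ^ 2
        + 2 * (∑ b ∈ edgesTouching Λ, κ b * h b * loopExtend Λ ζ b) + energyForm Λ κ ζ ζ := by
    rw [energyForm_apply, Finset.mul_sum, ← Finset.sum_add_distrib, ← Finset.sum_add_distrib]
    exact Finset.sum_congr rfl fun b _ => by simp only [Pi.add_apply]; ring
  rw [gaussFactor, gaussFactor, gaussWeight, ← ENNReal.ofReal_mul (Real.exp_pos _).le,
    ← Real.exp_add, hsq, hh ζ]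
  congr 2
  ring

theorem IsHarmonic.lintegral_mul_gaussFactor {η : Config d} {ζ₀ : loopSpace Λ}
    (hh : IsHarmonic Λ κ (η + loopExtend Λ ζ₀)) (F : Config d → ℝ≥0∞) :
    ∫⁻ ζ, F (η + loopExtend Λ ζ) * gaussFactor (edgesTouching Λ) κ (η + loopExtend Λ ζ)
      = gaussFactor (edgesTouching Λ) κ (η + loopExtend Λ ζ₀) *
        ∫⁻ ζ, F (η + loopExtend Λ ζ₀ + loopExtend Λ ζ) * gaussWeight (energyForm Λ κ) ζ := by
  rw [← lintegral_add_left_eq_self _ ζ₀,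
    ← lintegral_const_mul' (gaussFactor _ _ _) _ ENNReal.ofReal_ne_top]
  refine lintegral_congr fun ζ => ?_
  rw [map_add, ← add_assoc, hh.gaussFactor_add_loopExtend]
  ring

end EnergyForm

/-- The sum over the translations in `B` of the squares of the functional `pairing S G`,
truncated at `m`. -/
def truncSq (B : Finset (Site d)) (S : Finset (Edge d)) (G : Edge d → ℝ) (m : ℝ)
    (η : Config d) : ℝ :=
  ∑ x ∈ B, min (pairing S G (shift x η) ^ 2) m

/-- The bound of the finite-volume estimate: it involves first moments of the gradients and of the
heights (in the form of path sums) only. -/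
def errorTerm (B : Finset (Site d)) (S T : Finset (Edge d)) (c₀ c₁ c₂ : ℝ) (η : Config d) : ℝ :=
  c₀ + (c₁ * (∑ b ∈ T, |η b|)
    + c₂ * ∑ x ∈ B, ∑ b ∈ S, (|pathSum (b.1 + x) η| + |pathSum (b.head + x) η|))

@[fun_prop]
theorem measurable_truncSq (B : Finset (Site d)) (S : Finset (Edge d)) (G : Edge d → ℝ)
    (m : ℝ) : Measurable (truncSq B S G m) := by
  unfold truncSq
  fun_prop

@[fun_prop]
theorem measurable_errorTerm (B : Finset (Site d)) (S T : Finset (Edge d)) (c₀ c₁ c₂ : ℝ) :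
    Measurable (errorTerm B S T c₀ c₁ c₂) := by
  unfold errorTerm
  fun_prop

theorem errorTerm_nonneg (B : Finset (Site d)) (S T : Finset (Edge d)) {c₀ c₁ c₂ : ℝ}
    (hc₀ : 0 ≤ c₀) (hc₁ : 0 ≤ c₁) (hc₂ : 0 ≤ c₂) (η : Config d) :
    0 ≤ errorTerm B S T c₀ c₁ c₂ η := by
  unfold errorTerm
  positivity

theorem two_mul_ofReal (u : ℝ) : 2 * ENNReal.ofReal u = ENNReal.ofReal (2 * u) := by
  rw [ENNReal.ofReal_mul zero_le_two, ENNReal.ofReal_ofNat]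

theorem two_mul_abs_le (u v : ℝ) : 2 * |u| ≤ |u + v| + |u - v| := by
  calc 2 * |u| = |(u + v) + (u - v)| := by rw [add_add_sub_cancel, ← two_mul, abs_mul, abs_two]
    _ ≤ |u + v| + |u - v| := abs_add_le _ _

theorem pathSum_sub (z : Site d) (η ζ : Config d) :
    pathSum z (η - ζ) = pathSum z η - pathSum z ζ := by
  rw [eq_sub_iff_add_eq, ← pathSum_add, sub_add_cancel]

theorem two_mul_errorTerm_le (B : Finset (Site d)) (S T : Finset (Edge d)) (c₀ : ℝ) {c₁ c₂ : ℝ}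
    (hc₁ : 0 ≤ c₁) (hc₂ : 0 ≤ c₂) (η ζ : Config d) :
    2 * errorTerm B S T c₀ c₁ c₂ η ≤
      errorTerm B S T c₀ c₁ c₂ (η + ζ) + errorTerm B S T c₀ c₁ c₂ (η - ζ) := by
  have hedges : 2 * ∑ b ∈ T, |η b| ≤ ∑ b ∈ T, |(η + ζ) b| + ∑ b ∈ T, |(η - ζ) b| := by
    rw [Finset.mul_sum, ← Finset.sum_add_distrib]
    exact Finset.sum_le_sum fun b _ => two_mul_abs_le _ _
  let P (η : Config d) : ℝ :=
    ∑ x ∈ B, ∑ b ∈ S, (|pathSum (b.1 + x) η| + |pathSum (b.head + x) η|)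
  have hpaths : 2 * P η ≤ P (η + ζ) + P (η - ζ) := by
    simp only [P, Finset.mul_sum, ← Finset.sum_add_distrib, pathSum_add, pathSum_sub]
    refine Finset.sum_le_sum fun x _ => Finset.sum_le_sum fun b _ => ?_
    linarith [two_mul_abs_le (pathSum (b.1 + x) η) (pathSum (b.1 + x) ζ),
      two_mul_abs_le (pathSum (b.head + x) η) (pathSum (b.head + x) ζ)]
  unfold errorTerm
  linarith [mul_le_mul_of_nonneg_left hedges hc₁, mul_le_mul_of_nonneg_left hpaths hc₂]

theorem min_add_sq_le {u v m : ℝ} (hm : 0 ≤ m) :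
    min ((u + v) ^ 2) m ≤ 2 * v ^ 2 + 2 * min (u ^ 2) m := by
  have h : (u + v) ^ 2 ≤ 2 * u ^ 2 + 2 * v ^ 2 := by nlinarith [sq_nonneg (u - v)]
  rcases le_total (u ^ 2) m with hu | hu
  · rw [min_eq_left hu]
    exact (min_le_left _ _).trans (by linarith)
  · rw [min_eq_right hu]
    exact (min_le_right _ _).trans (by nlinarith [sq_nonneg v])

theorem truncSq_add_le (B : Finset (Site d)) (S : Finset (Edge d)) (G : Edge d → ℝ) {m : ℝ}
    (hm : 0 ≤ m) (η ζ : Config d) :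
    truncSq B S G m (η + ζ) ≤
      2 * (∑ x ∈ B, pairing S G (shift x ζ) ^ 2) + 2 * truncSq B S G m η := by
  simp only [truncSq, Finset.mul_sum, ← Finset.sum_add_distrib]
  refine Finset.sum_le_sum fun x _ => ?_
  rw [show shift x (η + ζ) = shift x η + shift x ζ from rfl, pairing_add]
  exact min_add_sq_le hm

section Fluctuation

variable {Λ B : Finset (Site d)} {S : Finset (Edge d)} {κ : Edge d → ℝ} {a Γ : ℝ} {G : Edge d → ℝ}

theorem pairing_shift_loopExtend_sq_le (ha : 0 < a) (hκ : ∀ b ∈ edgesTouching Λ, a ≤ κ b)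
    (hΓ : ∑ b ∈ S, G b ^ 2 ≤ Γ) {x : Site d} (hS : ∀ b ∈ S, b.translate x ∈ edgesTouching Λ)
    (ζ : loopSpace Λ) :
    pairing S G (shift x (loopExtend Λ ζ)) ^ 2 ≤ Γ / a * energyForm Λ κ ζ ζ := by
  have hshift : ∑ b ∈ S, shift x (loopExtend Λ ζ) b ^ 2
      ≤ ∑ b ∈ edgesTouching Λ, loopExtend Λ ζ b ^ 2 := by
    change ∑ b ∈ S, loopExtend Λ ζ (b.translate x) ^ 2 ≤ _
    rw [← Finset.sum_image (f := fun b => loopExtend Λ ζ b ^ 2)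
      (Edge.translate_injective x).injOn]
    exact Finset.sum_le_sum_of_subset_of_nonneg (Finset.image_subset_iff.2 hS)
      fun b _ _ => sq_nonneg _
  have hΓ0 : 0 ≤ Γ := (Finset.sum_nonneg fun b _ => sq_nonneg (G b)).trans hΓ
  rw [div_mul_eq_mul_div, le_div_iff₀ ha]
  calc pairing S G (shift x (loopExtend Λ ζ)) ^ 2 * a
      ≤ (Γ * ∑ b ∈ edgesTouching Λ, loopExtend Λ ζ b ^ 2) * a := by
        gcongr
        exact (pairing_sq_le S G _).trans (mul_le_mul hΓ hshift (by positivity) hΓ0)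
    _ = Γ * (a * ∑ b ∈ edgesTouching Λ, loopExtend Λ ζ b ^ 2) := by ring
    _ ≤ Γ * energyForm Λ κ ζ ζ := by gcongr; exact le_energyForm hκ ζ

theorem isLinearMap_pairing_shift (S : Finset (Edge d)) (G : Edge d → ℝ) (x : Site d) :
    IsLinearMap ℝ fun η : Config d => pairing S G (shift x η) where
  map_add _ _ := pairing_add S G _ _
  map_smul c η := by
    simp only [pairing, shift, Pi.smul_apply, smul_eq_mul, Finset.mul_sum, mul_left_comm]

theorem lintegral_sum_pairing_sq_mul_gaussWeight_le (ha : 0 < a)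
    (hκ : ∀ b ∈ edgesTouching Λ, a ≤ κ b) (hΓ0 : 0 < Γ) (hΓ : ∑ b ∈ S, G b ^ 2 ≤ Γ)
    (hS : ∀ x ∈ B, ∀ b ∈ S, b.translate x ∈ edgesTouching Λ) :
    ∫⁻ ζ, ENNReal.ofReal (∑ x ∈ B, pairing S G (shift x (loopExtend Λ ζ)) ^ 2)
        * gaussWeight (energyForm Λ κ) ζ ≤
      ENNReal.ofReal (B.card * (8 * (Γ / a))) * ∫⁻ ζ, gaussWeight (energyForm Λ κ) ζ := by
  simp only [ENNReal.ofReal_sum_of_nonneg fun _ _ => sq_nonneg _, Finset.sum_mul]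
  have hmeas (x : Site d) : Measurable fun ζ : loopSpace Λ =>
      ENNReal.ofReal (pairing S G (shift x (loopExtend Λ ζ)) ^ 2)
        * gaussWeight (energyForm Λ κ) ζ :=
    Measurable.mul (by fun_prop) (measurable_gaussWeight _)
  rw [lintegral_finsetSum _ fun x _ => hmeas x,
    ENNReal.ofReal_mul (Nat.cast_nonneg _), ENNReal.ofReal_natCast, mul_assoc, ← nsmul_eq_mul]
  refine Finset.sum_le_card_nsmul _ _ _ fun x hx => ?_
  exact lintegral_sq_mul_gaussWeight_le (energyForm_symm Λ κ) (eq_zero_of_energyForm_eq_zero ha hκ)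
    (l := (isLinearMap_pairing_shift S G x).mk' _ ∘ₗ loopExtend Λ) (by positivity)
    (pairing_shift_loopExtend_sq_le ha hκ hΓ (hS x hx))

end Fluctuation

/-- The geometric setting of the finite-volume estimate: a volume `Λ` with a cutoff function `ξ`
of slope at most `δ`, and a set `B` of translations that move the edges of `S` into the region
where the cutoff function is `1`. -/
structure IsCutoff (Λ B : Finset (Site d)) (S : Finset (Edge d)) (ξ : Site d → ℝ) (δ : ℝ) :
    Prop where
  nonneg_of_mem : ∀ x ∈ Λ, 0 ≤ x
  nonneg : ∀ x, 0 ≤ ξ x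
  lipschitz : ∀ b, |grad ξ b| ≤ δ
  eq_zero : ∀ b : Edge d, b ∉ edgesIn Λ → ξ b.1 = 0 ∧ ξ b.head = 0
  translate_mem : ∀ x ∈ B, ∀ b ∈ S, b.translate x ∈ edgesIn Λ
  eq_one : ∀ x ∈ B, ∀ b ∈ S, ξ (b.head + x) = 1

namespace IsCutoff

variable {Λ B : Finset (Site d)} {S : Finset (Edge d)} {ξ : Site d → ℝ} {δ : ℝ}
  {κ : Edge d → ℝ} {a A Γ t m : ℝ} {G : Edge d → ℝ} {h : Config d}

theorem mem_of_mem (hc : IsCutoff Λ B S ξ δ) {x : Site d} (hx : x ∈ B) {b : Edge d} (hb : b ∈ S) :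
    b.1 + x ∈ Λ ∧ b.head + x ∈ Λ := by
  have hmem := mem_edgesIn.1 (hc.translate_mem x hx b hb)
  rwa [Edge.head_translate] at hmem

theorem sum_grad_clip_eq_zero (hc : IsCutoff Λ B S ξ δ) (hh : IsHarmonic Λ κ h)
    (ψ : Site d → ℝ) :
    ∑ b ∈ edgesTouching Λ, κ b * h b * grad (fun x => ξ x * clip t (ψ x)) b = 0 := by
  obtain ⟨ζ, hζ⟩ := exists_loopExtend_eq_grad (Λ := Λ) (v := fun x => ξ x * clip t (ψ x))
    fun b hb => by simp [hc.eq_zero b hb]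
  rw [← hζ]
  exact hh ζ

theorem truncSq_le_of_isHarmonic (hc : IsCutoff Λ B S ξ δ) (ha : 0 < a)
    (hκ : ∀ b ∈ edgesTouching Λ, a ≤ κ b ∧ κ b ≤ A) (hA : 0 ≤ A) (hδ : 0 ≤ δ) (ht : 0 < t)
    (hm : 0 ≤ m) (hΓ : ∑ b ∈ S, G b ^ 2 ≤ Γ) (c₀ : ℝ) (hloop : LoopCondition h)
    (hh : IsHarmonic Λ κ h) :
    c₀ + truncSq B S G m h ≤
      errorTerm B S (edgesTouching Λ) c₀ (Γ * (S.card * (A * δ * t / a))) (m / t) h := by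
  obtain ⟨-, hgrad⟩ := hloop.height_spec
  have hheight {x : Site d} (hx : x ∈ Λ) : height h x = pathSum x h :=
    (hloop.pathSum_eq_height (hc.nonneg_of_mem x hx)).symm
  have key := sum_min_pairing_shift_le (ψ := height h) hκ ha ht hm G hc.nonneg hc.lipschitz
    (fun x hx b hb => ⟨edgesIn_subset_edgesTouching _ (hc.translate_mem x hx b hb),
      hc.eq_one x hx b hb⟩)
    (by rw [hgrad]; exact hc.sum_grad_clip_eq_zero hh _)
  rw [hgrad] at key
  have hpath : ∑ x ∈ B, ∑ b ∈ S, (|height h (b.1 + x)| + |height h (b.head + x)|)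
      = ∑ x ∈ B, ∑ b ∈ S, (|pathSum (b.1 + x) h| + |pathSum (b.head + x) h|) :=
    Finset.sum_congr rfl fun x hx => Finset.sum_congr rfl fun b hb => by
      rw [hheight (hc.mem_of_mem hx hb).1, hheight (hc.mem_of_mem hx hb).2]
  rw [hpath] at key
  unfold truncSq errorTerm
  gcongr
  exact key.trans (by gcongr)

theorem lintegral_truncSq_mul_gaussWeight_le (hc : IsCutoff Λ B S ξ δ) (ha : 0 < a)
    (hκ : ∀ b ∈ edgesTouching Λ, a ≤ κ b ∧ κ b ≤ A) (hA : 0 ≤ A) (hδ : 0 ≤ δ) (ht : 0 < t)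
    (hm : 0 ≤ m) (hΓ0 : 0 < Γ) (hΓ : ∑ b ∈ S, G b ^ 2 ≤ Γ) (hloop : LoopCondition h)
    (hh : IsHarmonic Λ κ h) :
    ∫⁻ ζ, ENNReal.ofReal (truncSq B S G m (h + loopExtend Λ ζ)) * gaussWeight (energyForm Λ κ) ζ ≤
      2 * ∫⁻ ζ, ENNReal.ofReal (errorTerm B S (edgesTouching Λ) (B.card * (8 * (Γ / a)))
        (Γ * (S.card * (A * δ * t / a))) (m / t) (h + loopExtend Λ ζ))
          * gaussWeight (energyForm Λ κ) ζ := by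
  set w := gaussWeight (energyForm Λ κ)
  set c₀ := B.card * (8 * (Γ / a))
  set N := errorTerm B S (edgesTouching Λ) c₀ (Γ * (S.card * (A * δ * t / a))) (m / t)
  have hw : Measurable w := measurable_gaussWeight _
  have hfluct : ∫⁻ ζ, ENNReal.ofReal (∑ x ∈ B, pairing S G (shift x (loopExtend Λ ζ)) ^ 2) * w ζ
      ≤ ENNReal.ofReal c₀ * ∫⁻ ζ, w ζ :=
    lintegral_sum_pairing_sq_mul_gaussWeight_le ha (fun b hb => (hκ b hb).1) hΓ0 hΓ
      fun x hx b hb => edgesIn_subset_edgesTouching _ (hc.translate_mem x hx b hb)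
  have hconvex : ENNReal.ofReal (N h) * ∫⁻ ζ, w ζ ≤
      ∫⁻ ζ, ENNReal.ofReal (N (h + loopExtend Λ ζ)) * w ζ := by
    refine mul_lintegral_gaussWeight_le _ (by fun_prop) fun ζ => ?_
    rw [two_mul_ofReal, map_neg, ← sub_eq_add_neg]
    exact (ENNReal.ofReal_le_ofReal (two_mul_errorTerm_le B S _ c₀ (by positivity)
      (by positivity) h _)).trans ENNReal.ofReal_add_le
  have htrunc : 0 ≤ truncSq B S G m h := Finset.sum_nonneg fun x _ => le_min (sq_nonneg _) hm
  calc ∫⁻ ζ, ENNReal.ofReal (truncSq B S G m (h + loopExtend Λ ζ)) * w ζ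
      ≤ ∫⁻ ζ, 2 * (ENNReal.ofReal (∑ x ∈ B, pairing S G (shift x (loopExtend Λ ζ)) ^ 2) * w ζ
          + ENNReal.ofReal (truncSq B S G m h) * w ζ) := by
        refine lintegral_mono fun ζ => ?_
        rw [← add_mul, ← mul_assoc, ← ENNReal.ofReal_add (by positivity) htrunc,
          two_mul_ofReal, mul_add]
        gcongr
        exact truncSq_add_le B S G hm h _
    _ = 2 * ((∫⁻ ζ, ENNReal.ofReal (∑ x ∈ B, pairing S G (shift x (loopExtend Λ ζ)) ^ 2) * w ζ)
          + ENNReal.ofReal (truncSq B S G m h) * ∫⁻ ζ, w ζ) := by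
        rw [lintegral_const_mul' _ _ ENNReal.ofNat_ne_top,
          lintegral_add_right _ (hw.const_mul _), lintegral_const_mul _ hw]
    _ ≤ 2 * (ENNReal.ofReal (N h) * ∫⁻ ζ, w ζ) := by
        gcongr
        refine (add_le_add_left hfluct _).trans ?_
        rw [← add_mul, ← ENNReal.ofReal_add (by positivity) htrunc]
        gcongr
        exact hc.truncSq_le_of_isHarmonic ha hκ hA hδ ht hm hΓ c₀ hloop hh
    _ ≤ 2 * ∫⁻ ζ, ENNReal.ofReal (N (h + loopExtend Λ ζ)) * w ζ := by gcongr

theorem lintegral_truncSq_mul_gaussFactor_le (hc : IsCutoff Λ B S ξ δ) (ha : 0 < a)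
    (hκ : ∀ b ∈ edgesTouching Λ, a ≤ κ b ∧ κ b ≤ A) (hA : 0 ≤ A) (hδ : 0 ≤ δ) (ht : 0 < t)
    (hm : 0 ≤ m) (hΓ0 : 0 < Γ) (hΓ : ∑ b ∈ S, G b ^ 2 ≤ Γ) {η : Config d}
    (hη : LoopCondition η) :
    ∫⁻ ζ, ENNReal.ofReal (truncSq B S G m (η + loopExtend Λ ζ))
        * gaussFactor (edgesTouching Λ) κ (η + loopExtend Λ ζ) ≤
      2 * ∫⁻ ζ, ENNReal.ofReal (errorTerm B S (edgesTouching Λ) (B.card * (8 * (Γ / a)))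
        (Γ * (S.card * (A * δ * t / a))) (m / t) (η + loopExtend Λ ζ))
          * gaussFactor (edgesTouching Λ) κ (η + loopExtend Λ ζ) := by
  obtain ⟨ζ₀, hh⟩ := exists_isHarmonic_add_loopExtend ha (fun b hb => (hκ b hb).1) η
  rw [hh.lintegral_mul_gaussFactor fun η => ENNReal.ofReal (truncSq B S G m η),
    hh.lintegral_mul_gaussFactor fun η => ENNReal.ofReal (errorTerm B S _ _ _ _ η),
    mul_left_comm]
  gcongr
  exact hc.lintegral_truncSq_mul_gaussWeight_le ha hκ hA hδ ht hm hΓ0 hΓ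
    (hη.add (loopCondition_loopExtend ζ₀)) hh

end IsCutoff

/-! ### The potential as a mixture of Gaussians -/

section Mixture

variable {ϱ : Measure ℝ} [IsFiniteMeasure ϱ] {a A : ℝ}

theorem integrable_exp_kappa (hϱ : ∀ᵐ κ ∂ϱ, 0 ≤ κ) (t : ℝ) :
    Integrable (fun κ => Real.exp (-(1 / 2) * κ * t ^ 2)) ϱ := by
  refine Integrable.of_bound (by fun_prop) 1 ?_
  filter_upwards [hϱ] with κ hκ
  rw [Real.norm_eq_abs, Real.abs_exp, Real.exp_le_one_iff]
  nlinarith [mul_nonneg hκ (sq_nonneg t)]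

theorem exp_neg_potential (hne : ϱ ≠ 0) (hϱ : ∀ᵐ κ ∂ϱ, 0 ≤ κ) (t : ℝ) :
    Real.exp (-potential ϱ t) = ∫ κ, Real.exp (-(1 / 2) * κ * t ^ 2) ∂ϱ := by
  rw [potential, neg_neg, Real.exp_log]
  have := NeZero.mk hne
  exact integral_exp_pos (integrable_exp_kappa hϱ t)

theorem measurable_potential : Measurable (potential ϱ) := by
  have h : StronglyMeasurable (Function.uncurry fun t κ : ℝ => Real.exp (-(1 / 2) * κ * t ^ 2)) :=
    (by fun_prop : Continuous _).stronglyMeasurable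
  exact (Real.measurable_log.comp h.integral_prod_right.measurable).neg

/-- Coupling constants on all edges from coupling constants on `T`. -/
def extendCoupling (T : Finset (Edge d)) (k : T → ℝ) (b : Edge d) : ℝ :=
  if h : b ∈ T then k ⟨b, h⟩ else 0

theorem gaussFactor_extendCoupling (T : Finset (Edge d)) (k : T → ℝ) (η : Config d) :
    gaussFactor T (extendCoupling T k) η
      = ENNReal.ofReal (∏ b : T, Real.exp (-(1 / 2) * k b * η b ^ 2)) := by
  rw [gaussFactor, ← Real.exp_sum, ← Finset.sum_coe_sort, Finset.mul_sum]
  congr 2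
  refine Finset.sum_congr rfl fun b _ => ?_
  rw [extendCoupling, dif_pos b.2, mul_assoc]

theorem ofReal_exp_neg_sum_potential (hne : ϱ ≠ 0) (hϱ : ∀ᵐ κ ∂ϱ, 0 ≤ κ)
    (T : Finset (Edge d)) (η : Config d) :
    ENNReal.ofReal (Real.exp (-∑ b ∈ T, potential ϱ (η b)))
      = ∫⁻ k, gaussFactor T (extendCoupling T k) η ∂(Measure.pi fun _ : T => ϱ) := by
  simp only [gaussFactor_extendCoupling]
  rw [← ofReal_integral_eq_lintegral_ofReal
    (Integrable.fintype_prod (f := fun (b : T) κ => Real.exp (-(1 / 2) * κ * η b ^ 2))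
      fun b => integrable_exp_kappa hϱ _)
    (Eventually.of_forall fun k => Finset.prod_nonneg fun _ _ => (Real.exp_pos _).le),
    integral_fintype_prod_eq_prod (𝕜 := ℝ)
      (f := fun (b : T) κ => Real.exp (-(1 / 2) * κ * η b ^ 2)),
    ← Finset.sum_neg_distrib, Real.exp_sum, ← Finset.prod_coe_sort]
  congr 1
  exact Finset.prod_congr rfl fun b _ => exp_neg_potential hne hϱ _

theorem ae_extendCoupling (hϱ : ∀ᵐ κ ∂ϱ, a ≤ κ ∧ κ ≤ A) (T : Finset (Edge d)) :
    ∀ᵐ k ∂(Measure.pi fun _ : T => ϱ), ∀ b ∈ T,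
      a ≤ extendCoupling T k b ∧ extendCoupling T k b ≤ A := by
  have h : ∀ᵐ k ∂(Measure.pi fun _ : T => ϱ), ∀ b : T, a ≤ k b ∧ k b ≤ A :=
    ae_all_iff.2 fun b => (Measure.tendsto_eval_ae_ae (μ := fun _ : T => ϱ) (i := b)).eventually hϱ
  filter_upwards [h] with k hk b hb
  rw [extendCoupling, dif_pos hb]
  exact hk ⟨b, hb⟩

theorem lintegral_gibbsWeight {V : ℝ → ℝ} (hV : Measurable V) (Λ : Finset (Site d))
    (η : Config d) {F : Config d → ℝ≥0∞} (hF : Measurable F) :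
    ∫⁻ η', F η' ∂(gibbsWeight V Λ η) = ∫⁻ ζ : loopSpace Λ, F (η + loopExtend Λ ζ) *
      ENNReal.ofReal (Real.exp (-∑ b ∈ edgesTouching Λ, V ((η + loopExtend Λ ζ) b))) := by
  have hW : Measurable fun η' : Config d =>
      ENNReal.ofReal (Real.exp (-∑ b ∈ edgesTouching Λ, V (η' b))) := by
    refine ENNReal.measurable_ofReal.comp (Real.measurable_exp.comp (Measurable.neg ?_))
    exact Finset.measurable_fun_sum _ fun b _ => hV.comp (measurable_pi_apply b)
  have hm : Measurable fun ζ : loopSpace Λ => η + loopExtend Λ ζ :=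
    (measurable_loopExtend Λ).const_add η
  rw [gibbsWeight, lintegral_withDensity_eq_lintegral_mul _ hW hF, aPriori]
  change ∫⁻ η', _ ∂(Measure.map (fun ζ : loopSpace Λ => η + loopExtend Λ ζ) volume) = _
  rw [lintegral_map (hW.mul hF) hm]
  exact lintegral_congr fun ζ => mul_comm _ _

theorem measurable_gaussFactor_extendCoupling (T : Finset (Edge d)) {X : Type*}
    [MeasurableSpace X] {f : X → Config d} {k : X → T → ℝ} (hf : Measurable f)
    (hk : Measurable k) : Measurable fun p => gaussFactor T (extendCoupling T (k p)) (f p) := by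
  simp only [gaussFactor_extendCoupling]
  refine ENNReal.measurable_ofReal.comp (Finset.measurable_fun_prod _ fun b _ => ?_)
  have h1 : Measurable fun p => f p b := (measurable_pi_apply _).comp hf
  have h2 : Measurable fun p => k p b := (measurable_pi_apply _).comp hk
  exact Real.measurable_exp.comp ((h2.const_mul _).mul (h1.pow_const 2))

theorem lintegral_mul_exp_potential (hne : ϱ ≠ 0) (hϱ : ∀ᵐ κ ∂ϱ, 0 ≤ κ)
    (T : Finset (Edge d)) {E : Type*} [MeasurableSpace E] (ν : Measure E) [SFinite ν]
    {f : E → Config d} (hf : Measurable f) {F : Config d → ℝ≥0∞} (hF : Measurable F) :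
    ∫⁻ ζ, F (f ζ) * ENNReal.ofReal (Real.exp (-∑ b ∈ T, potential ϱ (f ζ b))) ∂ν =
      ∫⁻ k, (∫⁻ ζ, F (f ζ) * gaussFactor T (extendCoupling T k) (f ζ) ∂ν)
        ∂(Measure.pi fun _ : T => ϱ) := by
  have hs : Measurable fun p : (T → ℝ) × E => f p.2 := hf.comp measurable_snd
  have hg2 : Measurable fun p : (T → ℝ) × E =>
      F (f p.2) * gaussFactor T (extendCoupling T p.1) (f p.2) :=
    (hF.comp hs).mul (measurable_gaussFactor_extendCoupling T hs measurable_fst)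
  rw [lintegral_lintegral_swap hg2.aemeasurable]
  refine lintegral_congr fun ζ => ?_
  rw [ofReal_exp_neg_sum_potential hne hϱ, lintegral_const_mul _
    (measurable_gaussFactor_extendCoupling T measurable_const measurable_id')]

theorem lintegral_gibbsWeight_potential (hne : ϱ ≠ 0) (hϱ : ∀ᵐ κ ∂ϱ, 0 ≤ κ)
    (Λ : Finset (Site d)) (η : Config d) {F : Config d → ℝ≥0∞} (hF : Measurable F) :
    ∫⁻ η', F η' ∂(gibbsWeight (potential ϱ) Λ η) =
      ∫⁻ k, (∫⁻ ζ : loopSpace Λ, F (η + loopExtend Λ ζ) *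
        gaussFactor (edgesTouching Λ) (extendCoupling (edgesTouching Λ) k) (η + loopExtend Λ ζ))
        ∂(Measure.pi fun _ : edgesTouching Λ => ϱ) := by
  rw [lintegral_gibbsWeight measurable_potential Λ η hF,
    lintegral_mul_exp_potential hne hϱ (edgesTouching Λ) volume
      ((measurable_loopExtend Λ).const_add η) hF]

theorem lintegral_gibbsSpec (V : ℝ → ℝ) (Λ : Finset (Site d)) (η : Config d)
    (F : Config d → ℝ≥0∞) : ∫⁻ η', F η' ∂(gibbsSpec V Λ η)
      = (gibbsWeight V Λ η Set.univ)⁻¹ * ∫⁻ η', F η' ∂(gibbsWeight V Λ η) := by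
  rw [gibbsSpec, lintegral_smul_measure, smul_eq_mul]

theorem sigmaOff_le (Λ : Finset (Site d)) :
    sigmaOff Λ ≤ (inferInstance : MeasurableSpace (Config d)) := by
  refine Measurable.comap_le ?_
  exact measurable_pi_lambda _ fun b => measurable_pi_apply _

theorem IsGradientGibbs.lintegral_eq {V : ℝ → ℝ} {μ : Measure (Config d)}
    [IsProbabilityMeasure μ] (hμ : IsGradientGibbs V μ) (Λ : Finset (Site d))
    {F : Config d → ℝ≥0∞} (hF : Measurable F) :
    ∫⁻ η, F η ∂μ = ∫⁻ η, ∫⁻ η', F η' ∂(gibbsSpec V Λ η) ∂μ := by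
  have h1 : ∫⁻ η, F η ∂μ = ∫⁻ η, ∫⁻ η', F η' ∂(condExpKernel μ (sigmaOff Λ) η) ∂μ := by
    conv_lhs => rw [← condExpKernel_comp_trim (μ := μ) (sigmaOff_le Λ)]
    rw [Measure.lintegral_bind (Kernel.aemeasurable _) hF.aemeasurable,
      lintegral_trim (sigmaOff_le Λ) hF.lintegral_kernel]
  rw [h1]
  refine lintegral_congr_ae ?_
  filter_upwards [hμ.gibbs Λ] with η hη
  rw [hη]

theorem IsGradientGibbs.lintegral_truncSq_le {μ : Measure (Config d)} [IsProbabilityMeasure μ]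
    (hμ : IsGradientGibbs (potential ϱ) μ) (hne : ϱ ≠ 0) (hϱ : ∀ᵐ κ ∂ϱ, a ≤ κ ∧ κ ≤ A)
    (ha : 0 < a) (hA : 0 ≤ A) {Λ B : Finset (Site d)} {S : Finset (Edge d)} {ξ : Site d → ℝ}
    {δ Γ t m : ℝ} {G : Edge d → ℝ} (hc : IsCutoff Λ B S ξ δ) (hδ : 0 ≤ δ) (ht : 0 < t)
    (hm : 0 ≤ m) (hΓ0 : 0 < Γ) (hΓ : ∑ b ∈ S, G b ^ 2 ≤ Γ) :
    ∫⁻ η, ENNReal.ofReal (truncSq B S G m η) ∂μ ≤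
      2 * ∫⁻ η, ENNReal.ofReal (errorTerm B S (edgesTouching Λ) (B.card * (8 * (Γ / a)))
        (Γ * (S.card * (A * δ * t / a))) (m / t) η) ∂μ := by
  have h0 : ∀ᵐ κ ∂ϱ, 0 ≤ κ := hϱ.mono fun κ h => ha.le.trans h.1
  have htrunc := (measurable_truncSq B S G m).ennreal_ofReal
  have herror := (measurable_errorTerm B S (edgesTouching Λ) (B.card * (8 * (Γ / a)))
    (Γ * (S.card * (A * δ * t / a))) (m / t)).ennreal_ofReal
  rw [hμ.lintegral_eq Λ htrunc, hμ.lintegral_eq Λ herror,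
    ← lintegral_const_mul' _ _ ENNReal.ofNat_ne_top]
  refine lintegral_mono_ae ?_
  filter_upwards [hμ.loop] with η hη
  rw [lintegral_gibbsSpec, lintegral_gibbsSpec,
    lintegral_gibbsWeight_potential hne h0 Λ η htrunc,
    lintegral_gibbsWeight_potential hne h0 Λ η herror,
    mul_left_comm, ← lintegral_const_mul' _ _ ENNReal.ofNat_ne_top]
  refine mul_le_mul' le_rfl (lintegral_mono_ae ?_)
  filter_upwards [ae_extendCoupling hϱ (edgesTouching Λ)] with k hk
  exact hc.lintegral_truncSq_mul_gaussFactor_le ha hk hA hδ ht hm hΓ0 hΓ hη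

end Mixture

/-! ### The mean ergodic theorem in `Lᵖ`, `p ≤ 2` -/

section MeanErgodic

theorem isClosed_setOf_cauchySeq {X E : Type*} [PseudoMetricSpace X] [PseudoMetricSpace E]
    {F : ℕ → X → E} (hF : UniformEquicontinuous F) : IsClosed {x | CauchySeq (F · x)} := by
  refine isClosed_of_closure_subset fun x hx => Metric.cauchySeq_iff'.2 fun ε hε => ?_
  obtain ⟨δ, hδ, hFδ⟩ := Metric.uniformEquicontinuous_iff.1 hF (ε / 3) (by positivity)
  obtain ⟨y, hy, hxy⟩ := Metric.mem_closure_iff.1 hx δ hδ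
  obtain ⟨N, hN⟩ := Metric.cauchySeq_iff'.1 hy (ε / 3) (by positivity)
  refine ⟨N, fun n hn => ?_⟩
  calc dist (F n x) (F N x) ≤ dist (F n x) (F n y) + dist (F n y) (F N y) + dist (F N y) (F N x) :=
        dist_triangle4 _ _ _ _
    _ < ε / 3 + ε / 3 + ε / 3 :=
        add_lt_add (add_lt_add (hFδ x y hxy n) (hN n hn)) (hFδ y x (dist_comm x y ▸ hxy) N)
    _ = ε := add_thirds ε

variable {Ω : Type*} [MeasurableSpace Ω] {μ : Measure Ω} {T : Ω → Ω} {p q : ℝ≥0∞}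

theorem uniformContinuous_inclusion_Lp [IsProbabilityMeasure μ] [Fact (1 ≤ p)] [Fact (1 ≤ q)]
    (hpq : p ≤ q) :
    UniformContinuous (AddSubgroup.inclusion (Lp.antitone hpq : Lp ℝ q μ ≤ Lp ℝ p μ)) := by
  refine (AddMonoidHomClass.lipschitz_of_bound _ 1 fun f => ?_).uniformContinuous
  rw [one_mul]
  exact ENNReal.toReal_mono (Lp.eLpNorm_ne_top f)
    (eLpNorm_le_eLpNorm_of_exponent_le hpq (Lp.aestronglyMeasurable f))

theorem dense_range_inclusion_Lp [IsFiniteMeasure μ] [Fact (1 ≤ p)] (hp : p ≠ ⊤) (hpq : p ≤ q) :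
    DenseRange (AddSubgroup.inclusion (Lp.antitone hpq : Lp ℝ q μ ≤ Lp ℝ p μ)) := by
  refine (Lp.simpleFunc.dense hp).mono ?_
  rintro f ⟨s, hs⟩
  exact ⟨(s.memLp_of_isFiniteMeasure q μ).toLp s, Subtype.ext hs⟩

theorem birkhoffAverage_inclusion_Lp [IsFiniteMeasure μ] (hT : MeasurePreserving T μ μ)
    (hpq : p ≤ q) (n : ℕ) (f : Lp ℝ q μ) :
    birkhoffAverage ℝ (Lp.compMeasurePreserving T hT) id n
        (AddSubgroup.inclusion (Lp.antitone hpq : Lp ℝ q μ ≤ Lp ℝ p μ) f) =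
      AddSubgroup.inclusion (Lp.antitone hpq)
        (birkhoffAverage ℝ (Lp.compMeasurePreserving T hT) id n f) := by
  have hsemi : Function.Semiconj (AddSubgroup.inclusion (Lp.antitone hpq : Lp ℝ q μ ≤ Lp ℝ p μ))
      (Lp.compMeasurePreserving T hT) (Lp.compMeasurePreserving T hT) := fun _ => rfl
  rw [map_birkhoffAverage ℝ ℝ]
  simp only [birkhoffAverage, birkhoffSum, Function.comp_apply, id, (hsemi.iterate_right _).eq]

theorem cauchySeq_birkhoffAverage_L2 (hT : MeasurePreserving T μ μ) (f : Lp ℝ 2 μ) :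
    CauchySeq (birkhoffAverage ℝ (Lp.compMeasurePreserving T hT) id · f) := by
  let K : Lp ℝ 2 μ →L[ℝ] Lp ℝ 2 μ := (Lp.compMeasurePreservingₗᵢ ℝ T hT).toContinuousLinearMap
  have hK : ⇑(Lp.compMeasurePreserving T hT) = K := rfl
  rw [hK]
  exact (K.tendsto_birkhoffAverage_orthogonalProjection
    (LinearIsometry.norm_toContinuousLinearMap_le _) f).cauchySeq

theorem exists_tendsto_birkhoffAverage_Lp [IsProbabilityMeasure μ] [Fact (1 ≤ p)] (hp : p ≤ 2)
    (hT : MeasurePreserving T μ μ) (f : Lp ℝ p μ) :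
    ∃ g, Tendsto (birkhoffAverage ℝ (Lp.compMeasurePreserving T hT) id · f) atTop (𝓝 g) := by
  have hequi : UniformEquicontinuous
      (birkhoffAverage ℝ (Lp.compMeasurePreserving (E := ℝ) (p := p) T hT) id) :=
    uniformEquicontinuous_birkhoffAverage ℝ (Lp.isometry_compMeasurePreserving hT).lipschitz
      uniformContinuous_id
  refine cauchySeq_tendsto_of_complete ?_
  refine (dense_range_inclusion_Lp (hp.trans_lt ENNReal.ofNat_lt_top).ne hp).induction_on
    (p := fun f => CauchySeq (birkhoffAverage ℝ (Lp.compMeasurePreserving T hT) id · f)) f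
    (isClosed_setOf_cauchySeq hequi) fun g => ?_
  convert (uniformContinuous_inclusion_Lp hp).comp_cauchySeq (cauchySeq_birkhoffAverage_L2 hT g)
    using 2 with n
  exact birkhoffAverage_inclusion_Lp hT hp n g

end MeanErgodic

/-! ### Consequences of ergodicity -/

theorem shift_shift (x y : Site d) (η : Config d) : shift x (shift y η) = shift (x + y) η := by
  funext b
  simp [shift, add_assoc]

theorem shift_zero (η : Config d) : shift 0 η = η := by
  funext b
  simp [shift]

section Ergodicity

variable {μ : Measure (Config d)}

theorem IsTranslationInvariant.measurePreserving (hinv : IsTranslationInvariant μ) (x : Site d) :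
    MeasurePreserving (shift x) μ μ :=
  ⟨measurable_shift x, hinv x⟩

/-- The group of translations that leave `U` unchanged up to a null set. -/
def IsTranslationInvariant.stabilizer (hinv : IsTranslationInvariant μ) (U : Config d → ℝ) :
    AddSubgroup (Site d) where
  carrier := {x | U ∘ shift x =ᵐ[μ] U}
  zero_mem' := ae_of_all μ fun η => congrArg U (shift_zero η)
  add_mem' := fun {x y} hx hy => by
    have h := (hinv.measurePreserving y).quasiMeasurePreserving.ae_eq_comp hx
    refine EventuallyEq.trans (.of_forall fun η => ?_) (h.trans hy)
    simp [shift_shift]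
  neg_mem' := fun {x} hx => by
    have h := (hinv.measurePreserving (-x)).quasiMeasurePreserving.ae_eq_comp hx
    refine EventuallyEq.trans h.symm (.of_forall fun η => ?_)
    simp [shift_shift, shift_zero]

theorem sum_smul_unitVec (x : Site d) : ∑ i, x i • unitVec i = x := by
  conv_rhs => rw [← Finset.univ_sum_single x]
  refine Finset.sum_congr rfl fun i _ => ?_
  simp [unitVec, ← Pi.single_smul]

theorem IsTranslationInvariant.ae_shift_eq_of_unitVec (hinv : IsTranslationInvariant μ)
    {U : Config d → ℝ} (hU : ∀ i, U ∘ shift (unitVec i) =ᵐ[μ] U) (x : Site d) :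
    U ∘ shift x =ᵐ[μ] U := by
  have hx : ∑ i, x i • unitVec i ∈ hinv.stabilizer U :=
    AddSubgroup.sum_mem _ fun i _ => AddSubgroup.zsmul_mem _ (hU i) _
  rwa [sum_smul_unitVec] at hx

theorem shift_preimage_iInter_preimage (A : Set (Config d)) (y : Site d) :
    shift y ⁻¹' (⋂ x, shift x ⁻¹' A) = ⋂ x, shift x ⁻¹' A := by
  ext η
  simp only [Set.mem_preimage, Set.mem_iInter, shift_shift]
  exact (Equiv.addRight y).forall_congr_right (q := fun x => shift x η ∈ A)

theorem IsErgodic.ae_eq_const [IsProbabilityMeasure μ] (herg : IsErgodic μ) {U : Config d → ℝ}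
    (hm : Measurable U) (hU : ∀ x : Site d, U ∘ shift x =ᵐ[μ] U) :
    ∃ c : ℝ, U =ᵐ[μ] fun _ => c := by
  refine exists_eventuallyEq_const_of_forall_separating MeasurableSet fun s hs => ?_
  let A := ⋂ x : Site d, shift x ⁻¹' (U ⁻¹' s)
  have hAm : MeasurableSet A := .iInter fun x => measurable_shift x (hm hs)
  have hA : ∀ᵐ η ∂μ, η ∈ A ↔ U η ∈ s := by
    filter_upwards [ae_all_iff.2 hU] with η hη
    have hη' (x : Site d) : U (shift x η) = U η := hη x
    simp only [A, Set.mem_iInter, Set.mem_preimage, hη', forall_const]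
  rcases herg A hAm (shift_preimage_iInter_preimage _) with h | h
  · right
    filter_upwards [hA, measure_eq_zero_iff_ae_notMem.1 h] with η h1 h2
    exact fun h3 => h2 (h1.2 h3)
  · left
    filter_upwards [hA, (prob_compl_eq_zero_iff hAm).2 h] with η h1 h2 using h1.1 h2

theorem IsErgodic.eq_zero_of_invariant [IsProbabilityMeasure μ] (herg : IsErgodic μ)
    (hinv : IsTranslationInvariant μ) {U : Lp ℝ 1 μ}
    (hU : ∀ i, Lp.compMeasurePreserving _ (hinv.measurePreserving (unitVec i)) U = U)
    (hint : ∫ η, U η ∂μ = 0) : U = 0 := by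
  have hUae (i : Fin d) : U ∘ shift (unitVec i) =ᵐ[μ] U := by
    have h := Lp.coeFn_compMeasurePreserving U (hinv.measurePreserving (unitVec i))
    rw [hU i] at h
    exact h.symm
  obtain ⟨c, hc⟩ := herg.ae_eq_const (Lp.stronglyMeasurable U).measurable
    (hinv.ae_shift_eq_of_unitVec hUae)
  have hc0 : c = 0 := by simpa [integral_congr_ae hc] using hint
  rw [hc0] at hc
  exact Lp.eq_zero_iff_ae_eq_zero.2 hc

/-! ### Sublinear growth along lines -/

theorem HasZeroTilt.memLp (htilt : HasZeroTilt μ) (b : Edge d) :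
    MemLp (fun η : Config d => η b) 1 μ :=
  memLp_one_iff_integrable.2 (htilt b).1

theorem HasZeroTilt.integrable_lineSum (htilt : HasZeroTilt μ) (x : Site d) (i : Fin d) (n : ℕ) :
    Integrable (lineSum x i n) μ :=
  integrable_finsetSum _ fun _ _ => (htilt _).1

theorem HasZeroTilt.integral_lineSum (htilt : HasZeroTilt μ) (x : Site d) (i : Fin d) (n : ℕ) :
    ∫ η, lineSum x i n η ∂μ = 0 := by
  simp only [lineSum, integral_finsetSum _ fun _ _ => (htilt _).1, (htilt _).2,
    Finset.sum_const_zero]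

/-- The coordinate `η_b` as an element of `L¹`. -/
def HasZeroTilt.edgeLp (htilt : HasZeroTilt μ) (b : Edge d) : Lp ℝ 1 μ :=
  (htilt.memLp b).toLp _

/-- The sum of the `η_b` along the straight path of length `n` from `0` in direction `i`, as an
element of `L¹`. -/
def HasZeroTilt.lineSumLp (htilt : HasZeroTilt μ) (i : Fin d) (n : ℕ) : Lp ℝ 1 μ :=
  (memLp_one_iff_integrable.2 (htilt.integrable_lineSum 0 i n)).toLp _

theorem HasZeroTilt.compMeasurePreserving_iterate_edgeLp (htilt : HasZeroTilt μ)
    (hinv : IsTranslationInvariant μ) (x : Site d) (n : ℕ) (b : Edge d) :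
    (Lp.compMeasurePreserving _ (hinv.measurePreserving x))^[n] (htilt.edgeLp b) =
      htilt.edgeLp (b.translate ((n : ℤ) • x)) := by
  induction n with
  | zero => simp [Edge.translate]
  | succ n ih =>
    have hsucc : (b.translate ((n : ℤ) • x)).translate x =
        b.translate (((n + 1 : ℕ) : ℤ) • x) := by
      simp [Edge.translate, add_smul, add_assoc]
    rw [Function.iterate_succ_apply', ih, ← hsucc]
    rfl

theorem HasZeroTilt.birkhoffSum_edgeLp (htilt : HasZeroTilt μ) (hinv : IsTranslationInvariant μ)
    (i : Fin d) (n : ℕ) :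
    birkhoffSum (Lp.compMeasurePreserving _ (hinv.measurePreserving (unitVec i))) id n
      (htilt.edgeLp (0, i)) = htilt.lineSumLp i n := by
  induction n with
  | zero =>
    rw [birkhoffSum_zero]
    refine (Lp.eq_zero_iff_ae_eq_zero.2 ((MemLp.coeFn_toLp _).trans (.of_forall fun η => ?_))).symm
    simp [lineSum]
  | succ n ih =>
    rw [birkhoffSum_succ, ih, id, htilt.compMeasurePreserving_iterate_edgeLp hinv, lineSumLp,
      edgeLp, ← MemLp.toLp_add]
    refine MemLp.toLp_congr _ _ (.of_forall fun η => ?_)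
    simp [lineSum, Finset.sum_range_succ, Edge.translate]

theorem LoopCondition.lineSum_shift_sub {η : Config d} (hη : LoopCondition η) (i j : Fin d)
    (n : ℕ) : lineSum 0 i n (shift (unitVec j) η) - lineSum 0 i n η =
      shift ((n : ℤ) • unitVec i) η (0, j) - η (0, j) := by
  obtain ⟨φ, -, rfl⟩ := hη.exists_eq_grad
  simp only [shift_grad, lineSum_grad, grad, Edge.head]
  rw [add_right_comm]
  ring

theorem HasZeroTilt.norm_compMeasurePreserving_lineSumLp_sub_le (htilt : HasZeroTilt μ)
    (hloop : ∀ᵐ η ∂μ, LoopCondition η) (hinv : IsTranslationInvariant μ) (i j : Fin d) (n : ℕ) :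
    ‖Lp.compMeasurePreserving _ (hinv.measurePreserving (unitVec j)) (htilt.lineSumLp i n) -
      htilt.lineSumLp i n‖ ≤ 2 * ‖htilt.edgeLp (0, j)‖ := by
  have hshift := hinv.measurePreserving ((n : ℤ) • unitVec i)
  have heq : Lp.compMeasurePreserving _ (hinv.measurePreserving (unitVec j))
      (htilt.lineSumLp i n) - htilt.lineSumLp i n =
      Lp.compMeasurePreserving _ hshift (htilt.edgeLp (0, j)) - htilt.edgeLp (0, j) := by
    simp only [lineSumLp, edgeLp, Lp.toLp_compMeasurePreserving, ← MemLp.toLp_sub]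
    refine MemLp.toLp_congr _ _ ?_
    filter_upwards [hloop] with η hη using hη.lineSum_shift_sub i j n
  rw [heq, two_mul]
  exact (norm_sub_le _ _).trans_eq (by rw [Lp.norm_compMeasurePreserving])

theorem HasZeroTilt.compMeasurePreserving_eq_of_tendsto (htilt : HasZeroTilt μ)
    (hloop : ∀ᵐ η ∂μ, LoopCondition η) (hinv : IsTranslationInvariant μ) {i : Fin d}
    {U : Lp ℝ 1 μ} (hU : Tendsto (fun n : ℕ => (n : ℝ)⁻¹ • htilt.lineSumLp i n) atTop (𝓝 U))
    (j : Fin d) : Lp.compMeasurePreserving _ (hinv.measurePreserving (unitVec j)) U = U := by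
  let K := Lp.compMeasurePreservingₗᵢ (E := ℝ) (p := 1) ℝ _ (hinv.measurePreserving (unitVec j))
  have hdiff : Tendsto (fun n : ℕ => (n : ℝ)⁻¹ • (K (htilt.lineSumLp i n) - htilt.lineSumLp i n))
      atTop (𝓝 0) := by
    refine squeeze_zero_norm (a := fun n : ℕ => (n : ℝ)⁻¹ * (2 * ‖htilt.edgeLp (0, j)‖))
      (fun n => ?_) (by simpa using (tendsto_inv_atTop_nhds_zero_nat (𝕜 := ℝ)).mul_const _)
    rw [norm_smul, norm_inv, Real.norm_natCast]
    gcongr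
    exact htilt.norm_compMeasurePreserving_lineSumLp_sub_le hloop hinv i j n
  have hK := ((K.continuous.tendsto U).comp hU).sub hU
  refine sub_eq_zero.1 (tendsto_nhds_unique (hK.congr fun n => ?_) hdiff)
  rw [Function.comp_apply, map_smul, smul_sub]

theorem tendsto_inv_smul_lineSumLp [IsProbabilityMeasure μ] (hloop : ∀ᵐ η ∂μ, LoopCondition η)
    (hinv : IsTranslationInvariant μ) (herg : IsErgodic μ) (htilt : HasZeroTilt μ) (i : Fin d) :
    Tendsto (fun n : ℕ => (n : ℝ)⁻¹ • htilt.lineSumLp i n) atTop (𝓝 0) := by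
  obtain ⟨U, hU⟩ := exists_tendsto_birkhoffAverage_Lp one_le_two
    (hinv.measurePreserving (unitVec i)) (htilt.edgeLp (0, i))
  simp only [birkhoffAverage, htilt.birkhoffSum_edgeLp hinv] at hU
  have hzero (n : ℕ) : ∫ η, ((n : ℝ)⁻¹ • htilt.lineSumLp i n) η ∂μ = 0 := by
    rw [integral_congr_ae (Lp.coeFn_smul _ _)]
    simp only [Pi.smul_apply, integral_smul]
    rw [HasZeroTilt.lineSumLp, integral_congr_ae (MemLp.coeFn_toLp _), htilt.integral_lineSum,
      smul_zero]
  have hint : ∫ η, U η ∂μ = 0 :=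
    tendsto_nhds_unique ((continuous_integral.tendsto U).comp hU)
      (tendsto_const_nhds.congr fun n => (hzero n).symm)
  rwa [herg.eq_zero_of_invariant hinv
    (htilt.compMeasurePreserving_eq_of_tendsto hloop hinv hU) hint] at hU

theorem tendsto_inv_mul_integral_abs_lineSum [IsProbabilityMeasure μ]
    (hloop : ∀ᵐ η ∂μ, LoopCondition η) (hinv : IsTranslationInvariant μ) (herg : IsErgodic μ)
    (htilt : HasZeroTilt μ) (i : Fin d) :
    Tendsto (fun n : ℕ => (n : ℝ)⁻¹ * ∫ η, |lineSum 0 i n η| ∂μ) atTop (𝓝 0) := by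
  have h := (tendsto_inv_smul_lineSumLp hloop hinv herg htilt i).norm
  rw [norm_zero] at h
  refine h.congr fun n => ?_
  rw [norm_smul, norm_inv, Real.norm_natCast, L1.norm_eq_integral_norm]
  refine congrArg _ (integral_congr_ae ?_)
  filter_upwards [MemLp.coeFn_toLp (memLp_one_iff_integrable.2 (htilt.integrable_lineSum 0 i n))]
    with η hη
  rw [HasZeroTilt.lineSumLp, hη, Real.norm_eq_abs]

end Ergodicity

/-! ### Cutoff functions on boxes -/

theorem norm_unitVec_le (i : Fin d) : ‖(unitVec i : Site d)‖ ≤ 1 := by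
  rw [pi_norm_le_iff_of_nonneg zero_le_one]
  intro j
  simp only [unitVec, Pi.single_apply]
  split_ifs <;> simp

theorem site_norm_le_iff {x : Site d} {n : ℕ} : ‖x‖ ≤ n ↔ ∀ i, |x i| ≤ (n : ℤ) := by
  rw [pi_norm_le_iff_of_nonneg (by positivity)]
  refine forall_congr' fun i => ?_
  rw [Int.norm_eq_abs]
  exact_mod_cast Iff.rfl

theorem site_norm_lt_add_one_iff {x : Site d} {n : ℕ} : ‖x‖ < n + 1 ↔ ‖x‖ ≤ n := by
  rw [site_norm_le_iff, pi_norm_lt_iff (by positivity)]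
  refine forall_congr' fun i => ?_
  rw [Int.norm_eq_abs, ← Int.lt_add_one_iff]
  exact_mod_cast Iff.rfl

theorem abs_norm_head_sub_sub_norm_sub_le (b : Edge d) (c : Site d) :
    |‖b.head - c‖ - ‖b.1 - c‖| ≤ 1 := by
  refine (abs_norm_sub_norm_le _ _).trans ?_
  rw [sub_sub_sub_cancel_right, Edge.head, add_sub_cancel_left]
  exact norm_unitVec_le _

/-- The box `[lo, hi]^d`. -/
def box (d lo hi : ℕ) : Finset (Site d) := Finset.Icc (fun _ => (lo : ℤ)) (fun _ => (hi : ℤ))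

theorem mem_box {lo hi : ℕ} {x : Site d} : x ∈ box d lo hi ↔ ∀ i, (lo : ℤ) ≤ x i ∧ x i ≤ hi := by
  rw [box, Finset.mem_Icc, Pi.le_def, Pi.le_def, ← forall_and]

theorem card_box (d lo hi : ℕ) : (box d lo hi).card = (hi + 1 - lo) ^ d := by
  simp only [box, Pi.card_Icc, Int.card_Icc, Finset.prod_const, Finset.card_univ, Fintype.card_fin]
  congr 1
  omega

theorem card_edgesTouching_le (Λ : Finset (Site d)) :
    (edgesTouching Λ).card ≤ 2 * (d * Λ.card) := by
  have h : (Λ ×ˢ (Finset.univ : Finset (Fin d))).card = d * Λ.card := by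
    rw [Finset.card_product, Finset.card_univ, Fintype.card_fin, mul_comm]
  refine (Finset.card_union_le _ _).trans ?_
  rw [two_mul]
  exact Nat.add_le_add h.le (Finset.card_image_le.trans h.le)

theorem card_edgesTouching_box_le (d k : ℕ) :
    (edgesTouching (box d 0 (8 * k))).card ≤ 2 * d * 4 ^ d * (box d (3 * k) (5 * k)).card := by
  refine (card_edgesTouching_le _).trans ?_
  rw [card_box, card_box, mul_assoc 2, mul_assoc 2, mul_assoc d, ← mul_pow]
  gcongr
  omega

/-- The site `(n, …, n)`, which is the centre of the box `[n - k, n + k]^d`. -/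
def boxCenter (d n : ℕ) : Site d := fun _ => n

theorem norm_sub_boxCenter_le_iff {n k lo hi : ℕ} (hlo : lo + k = n) (hhi : n + k = hi)
    {x : Site d} : ‖x - boxCenter d n‖ ≤ k ↔ x ∈ box d lo hi := by
  rw [site_norm_le_iff, mem_box]
  refine forall_congr' fun i => ?_
  rw [abs_le, Pi.sub_apply, boxCenter]
  omega

/-- The cutoff function of the box `[0, 8k]^d`, equal to `1` within distance `2k` of the centre. -/
def boxCutoff (d k : ℕ) (x : Site d) : ℝ :=
  max 0 (min 1 (2 - ‖x - boxCenter d (4 * k)‖ / (2 * k)))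

section BoxCutoff

variable {k : ℕ}

theorem boxCutoff_eq_one (hk : 0 < k) {x : Site d} (h : ‖x - boxCenter d (4 * k)‖ ≤ 2 * k) :
    boxCutoff d k x = 1 := by
  have hle : ‖x - boxCenter d (4 * k)‖ / (2 * k) ≤ 1 := (div_le_one (by positivity)).2 h
  rw [boxCutoff, min_eq_left (by linarith), max_eq_right zero_le_one]

theorem boxCutoff_eq_zero (hk : 0 < k) {x : Site d} (h : 4 * k ≤ ‖x - boxCenter d (4 * k)‖) :
    boxCutoff d k x = 0 := by
  have hle : 2 ≤ ‖x - boxCenter d (4 * k)‖ / (2 * k) :=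
    (le_div_iff₀ (by positivity)).2 (by linarith)
  exact max_eq_left ((min_le_right _ _).trans (by linarith))

theorem abs_grad_boxCutoff_le (d k : ℕ) (b : Edge d) :
    |grad (boxCutoff d k) b| ≤ 1 / (2 * k) := by
  have hsub (u v : ℝ) : 2 - u / (2 * k) - (2 - v / (2 * k)) = -((u - v) / (2 * k)) := by ring
  simp only [grad, boxCutoff]
  refine (abs_max_sub_max_le_max _ _ _ _).trans (max_le (by simp) ?_)
  refine (abs_min_sub_min_le_max _ _ _ _).trans (max_le (by simp) ?_)
  rw [hsub, abs_neg, abs_div, abs_of_nonneg (by positivity : (0 : ℝ) ≤ 2 * k)]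
  gcongr
  exact abs_norm_head_sub_sub_norm_sub_le b _

theorem add_one_le_norm_sub_boxCenter {x : Site d} (hx : x ∉ box d 0 (8 * k)) :
    4 * (k : ℝ) + 1 ≤ ‖x - boxCenter d (4 * k)‖ := by
  rw [← norm_sub_boxCenter_le_iff (n := 4 * k) (k := 4 * k) (by omega) (by omega),
    ← site_norm_lt_add_one_iff, not_lt] at hx
  exact_mod_cast hx

theorem boxCutoff_eq_zero_of_notMem_edgesIn (hk : 0 < k) {b : Edge d}
    (hb : b ∉ edgesIn (box d 0 (8 * k))) : boxCutoff d k b.1 = 0 ∧ boxCutoff d k b.head = 0 := by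
  have hdist := abs_le.1 (abs_norm_head_sub_sub_norm_sub_le b (boxCenter d (4 * k)))
  have hfar : 4 * (k : ℝ) + 1 ≤ ‖b.1 - boxCenter d (4 * k)‖ ∨
      4 * (k : ℝ) + 1 ≤ ‖b.head - boxCenter d (4 * k)‖ := by
    rw [mem_edgesIn, not_and_or] at hb
    exact hb.imp add_one_le_norm_sub_boxCenter add_one_le_norm_sub_boxCenter
  rcases hfar with h | h <;>
    exact ⟨boxCutoff_eq_zero hk (by linarith), boxCutoff_eq_zero hk (by linarith)⟩

theorem norm_add_sub_boxCenter_le {x y : Site d} (hx : x ∈ box d (3 * k) (5 * k))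
    (hy : ‖y‖ ≤ k) : ‖y + x - boxCenter d (4 * k)‖ ≤ 2 * k := by
  have hx' := (norm_sub_boxCenter_le_iff (n := 4 * k) (k := k) (by omega) (by omega)).2 hx
  rw [add_sub_assoc]
  exact (norm_add_le _ _).trans (by linarith)

theorem add_mem_box {x y : Site d} (hx : x ∈ box d (3 * k) (5 * k)) (hy : ‖y‖ ≤ k) :
    y + x ∈ box d 0 (8 * k) := by
  refine (norm_sub_boxCenter_le_iff (n := 4 * k) (k := 4 * k) (by omega) (by omega)).1 ?_
  refine (norm_add_sub_boxCenter_le hx hy).trans ?_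
  push_cast
  linarith [(Nat.cast_nonneg k : (0 : ℝ) ≤ k)]

theorem isCutoff_box (hk : 0 < k) {S : Finset (Edge d)}
    (hS : ∀ b ∈ S, ‖b.1‖ ≤ k ∧ ‖b.head‖ ≤ k) :
    IsCutoff (box d 0 (8 * k)) (box d (3 * k) (5 * k)) S (boxCutoff d k) (1 / (2 * k)) where
  nonneg_of_mem x hx i := by simpa using (mem_box.1 hx i).1
  nonneg x := le_max_left _ _
  lipschitz := abs_grad_boxCutoff_le d k
  eq_zero b hb := boxCutoff_eq_zero_of_notMem_edgesIn hk hb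
  translate_mem x hx b hb := by
    rw [mem_edgesIn, Edge.head_translate]
    exact ⟨add_mem_box hx (hS b hb).1, add_mem_box hx (hS b hb).2⟩
  eq_one x hx b hb := boxCutoff_eq_one hk (norm_add_sub_boxCenter_le hx (hS b hb).2)

end BoxCutoff

/-! ### First moments -/

section Moments

variable {μ : Measure (Config d)}

theorem IsTranslationInvariant.integral_shift (hinv : IsTranslationInvariant μ) {F : Config d → ℝ}
    (hF : Measurable F) (x : Site d) : ∫ η, F (shift x η) ∂μ = ∫ η, F η ∂μ := by
  conv_rhs => rw [← hinv x]
  exact (integral_map (measurable_shift x).aemeasurable hF.aestronglyMeasurable).symm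

theorem IsTranslationInvariant.integral_abs_lineSum (hinv : IsTranslationInvariant μ)
    (x : Site d) (i : Fin d) (n : ℕ) :
    ∫ η, |lineSum x i n η| ∂μ = ∫ η, |lineSum 0 i n η| ∂μ := by
  rw [← hinv.integral_shift (F := fun η => |lineSum 0 i n η|) (by fun_prop) x]
  simp only [lineSum, shift, zero_add, add_comm x]

theorem IsTranslationInvariant.exists_integral_abs_le (hinv : IsTranslationInvariant μ) :
    ∃ M : ℝ, 0 ≤ M ∧ ∀ b : Edge d, ∫ η, |η b| ∂μ ≤ M := by
  have hnonneg (i : Fin d) : 0 ≤ ∫ η, |η (0, i)| ∂μ := integral_nonneg fun η => abs_nonneg _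
  refine ⟨∑ i, ∫ η, |η (0, i)| ∂μ, Finset.sum_nonneg fun i _ => hnonneg i, fun b => ?_⟩
  have hb := hinv.integral_shift (F := fun η => |η (0, b.2)|) (by fun_prop) b.1
  simp only [shift, zero_add] at hb
  rw [hb]
  exact Finset.single_le_sum (fun i _ => hnonneg i) (Finset.mem_univ b.2)

theorem HasZeroTilt.integrable_pathSum (htilt : HasZeroTilt μ) (z : Site d) :
    Integrable (pathSum z) μ :=
  integrable_finsetSum _ fun _ _ => htilt.integrable_lineSum _ _ _

theorem eventually_forall_le_mul_of_tendsto_inv_mul {u : ℕ → ℝ}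
    (hu : Tendsto (fun n : ℕ => (n : ℝ)⁻¹ * u n) atTop (𝓝 0)) {ε : ℝ} (hε : 0 < ε) :
    ∀ᶠ N : ℕ in atTop, ∀ n ≤ N, u n ≤ ε * N := by
  obtain ⟨N₁, hN₁⟩ := eventually_atTop.1 (hu.eventually (gt_mem_nhds hε))
  have hsmall : ∀ᶠ N : ℕ in atTop, ∀ n ∈ Finset.range (N₁ + 1), u n ≤ ε * N :=
    (Finset.eventually_all _).2 fun n _ =>
      (tendsto_natCast_atTop_atTop.const_mul_atTop hε).eventually_ge_atTop (u n)
  filter_upwards [hsmall] with N hN n hn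
  rcases le_or_gt n N₁ with h | h
  · exact hN n (Finset.mem_range.2 (by omega))
  · have hn0 : (0 : ℝ) < n := by exact_mod_cast (by omega : 0 < n)
    calc u n ≤ n * ε := (inv_mul_le_iff₀ hn0).1 (hN₁ n h.le).le
      _ ≤ ε * N := by rw [mul_comm]; gcongr

theorem eventually_integral_abs_pathSum_le [IsProbabilityMeasure μ]
    (hloop : ∀ᵐ η ∂μ, LoopCondition η) (hinv : IsTranslationInvariant μ) (herg : IsErgodic μ)
    (htilt : HasZeroTilt μ) {ε : ℝ} (hε : 0 < ε) :
    ∀ᶠ N : ℕ in atTop, ∀ z ∈ box d 0 N, ∫ η, |pathSum z η| ∂μ ≤ d * (ε * N) := by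
  have hline : ∀ᶠ N : ℕ in atTop, ∀ i : Fin d, ∀ n ≤ N, ∫ η, |lineSum 0 i n η| ∂μ ≤ ε * N :=
    eventually_all.2 fun i => eventually_forall_le_mul_of_tendsto_inv_mul
      (tendsto_inv_mul_integral_abs_lineSum hloop hinv herg htilt i) hε
  filter_upwards [hline] with N hN z hz
  have hint (i : Fin d) := (htilt.integrable_lineSum (truncSite z i) i (z i).toNat).abs
  calc ∫ η, |pathSum z η| ∂μ
      ≤ ∫ η, ∑ i : Fin d, |lineSum (truncSite z i) i (z i).toNat η| ∂μ :=
        integral_mono (htilt.integrable_pathSum z).abs (integrable_finsetSum _ fun i _ => hint i)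
          fun η => Finset.abs_sum_le_sum_abs _ _
    _ = ∑ i : Fin d, ∫ η, |lineSum 0 i (z i).toNat η| ∂μ := by
        rw [integral_finsetSum _ fun i _ => hint i]
        exact Finset.sum_congr rfl fun i _ => hinv.integral_abs_lineSum _ _ _
    _ ≤ ∑ _i : Fin d, ε * N :=
        Finset.sum_le_sum fun i _ => hN i _ (Int.toNat_le.2 (mem_box.1 hz i).2)
    _ = d * (ε * N) := by simp

theorem integrable_min_pairing_sq [IsFiniteMeasure μ] (S : Finset (Edge d)) (G : Edge d → ℝ)
    {m : ℝ} (hm : 0 ≤ m) : Integrable (fun η => min (pairing S G η ^ 2) m) μ := by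
  refine .of_bound (by fun_prop) m (.of_forall fun η => ?_)
  rw [Real.norm_of_nonneg (le_min (sq_nonneg _) hm)]
  exact min_le_right _ _

theorem integrable_min_pairing_shift_sq [IsFiniteMeasure μ] (S : Finset (Edge d))
    (G : Edge d → ℝ) {m : ℝ} (hm : 0 ≤ m) (hinv : IsTranslationInvariant μ) (x : Site d) :
    Integrable (fun η => min (pairing S G (shift x η) ^ 2) m) μ :=
  (hinv.measurePreserving x).integrable_comp_of_integrable (integrable_min_pairing_sq S G hm)

theorem IsTranslationInvariant.integral_truncSq [IsFiniteMeasure μ]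
    (hinv : IsTranslationInvariant μ) (B : Finset (Site d)) (S : Finset (Edge d))
    (G : Edge d → ℝ) {m : ℝ} (hm : 0 ≤ m) :
    ∫ η, truncSq B S G m η ∂μ = B.card * ∫ η, min (pairing S G η ^ 2) m ∂μ := by
  have hshift := hinv.integral_shift (F := fun η => min (pairing S G η ^ 2) m) (by fun_prop)
  simp only [truncSq]
  rw [integral_finsetSum _ fun x _ => integrable_min_pairing_shift_sq S G hm hinv x]
  simp only [hshift, Finset.sum_const, nsmul_eq_mul]

theorem integral_const_add_mul_add_mul [IsProbabilityMeasure μ] {X Y : Config d → ℝ}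
    (hX : Integrable X μ) (hY : Integrable Y μ) (c₀ c₁ c₂ : ℝ) :
    ∫ η, (c₀ + (c₁ * X η + c₂ * Y η)) ∂μ = c₀ + (c₁ * ∫ η, X η ∂μ + c₂ * ∫ η, Y η ∂μ) := by
  have hXY : Integrable (fun η => c₁ * X η + c₂ * Y η) μ :=
    (hX.const_mul c₁).add (hY.const_mul c₂)
  rw [integral_add (integrable_const _) hXY, integral_add (hX.const_mul c₁) (hY.const_mul c₂)]
  simp [integral_const_mul]

theorem HasZeroTilt.integrable_errorTerm [IsFiniteMeasure μ] (htilt : HasZeroTilt μ)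
    (B : Finset (Site d)) (S T : Finset (Edge d)) (c₀ c₁ c₂ : ℝ) :
    Integrable (errorTerm B S T c₀ c₁ c₂) μ :=
  (integrable_const _).add (((integrable_finsetSum _ fun b _ => (htilt b).1.abs).const_mul _).add
    ((integrable_finsetSum _ fun _ _ => integrable_finsetSum _ fun _ _ =>
      (htilt.integrable_pathSum _).abs.add (htilt.integrable_pathSum _).abs).const_mul _))

theorem HasZeroTilt.integral_errorTerm_le [IsProbabilityMeasure μ] (htilt : HasZeroTilt μ)
    {B : Finset (Site d)} {S : Finset (Edge d)} (T : Finset (Edge d)) (c₀ : ℝ) {c₁ c₂ M P : ℝ}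
    (hc₁ : 0 ≤ c₁) (hc₂ : 0 ≤ c₂) (hM : ∀ b : Edge d, ∫ η, |η b| ∂μ ≤ M)
    (hP : ∀ x ∈ B, ∀ b ∈ S, ∫ η, |pathSum (b.1 + x) η| ∂μ ≤ P ∧
      ∫ η, |pathSum (b.head + x) η| ∂μ ≤ P) :
    ∫ η, errorTerm B S T c₀ c₁ c₂ η ∂μ ≤
      c₀ + (c₁ * (T.card * M) + c₂ * (B.card * (S.card * (P + P)))) := by
  have hpath (z : Site d) := (htilt.integrable_pathSum z).abs
  have hends (x : Site d) (b : Edge d) :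
      Integrable (fun η => |pathSum (b.1 + x) η| + |pathSum (b.head + x) η|) μ :=
    (hpath _).add (hpath _)
  simp only [errorTerm]
  rw [integral_const_add_mul_add_mul (integrable_finsetSum _ fun b _ => (htilt b).1.abs)
      (integrable_finsetSum _ fun x _ => integrable_finsetSum _ fun b _ => hends x b),
    integral_finsetSum _ fun b _ => (htilt b).1.abs,
    integral_finsetSum _ fun x _ => integrable_finsetSum _ fun b _ => hends x b]
  gcongr
  · rw [← nsmul_eq_mul]
    exact Finset.sum_le_card_nsmul _ _ _ fun b _ => hM b
  · rw [← nsmul_eq_mul]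
    refine Finset.sum_le_card_nsmul _ _ _ fun x hx => ?_
    rw [integral_finsetSum _ fun b _ => hends x b, ← nsmul_eq_mul]
    refine Finset.sum_le_card_nsmul _ _ _ fun b hb => ?_
    rw [integral_add (hpath _) (hpath _)]
    exact add_le_add (hP x hx b hb).1 (hP x hx b hb).2

end Moments

/-! ### The variance bound -/

section Variance

variable {ϱ : Measure ℝ} [IsFiniteMeasure ϱ] {a A : ℝ} {μ : Measure (Config d)}
  [IsProbabilityMeasure μ] {S : Finset (Edge d)} {G : Edge d → ℝ} {Γ m : ℝ}

theorem IsGradientGibbs.integral_truncSq_le (hμ : IsGradientGibbs (potential ϱ) μ) (hne : ϱ ≠ 0)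
    (hϱ : ∀ᵐ κ ∂ϱ, a ≤ κ ∧ κ ≤ A) (ha : 0 < a) (hA : 0 ≤ A) (hinv : IsTranslationInvariant μ)
    (htilt : HasZeroTilt μ) {Λ B : Finset (Site d)} {ξ : Site d → ℝ} {δ t : ℝ}
    (hc : IsCutoff Λ B S ξ δ) (hδ : 0 ≤ δ) (ht : 0 < t) (hm : 0 ≤ m) (hΓ0 : 0 < Γ)
    (hΓ : ∑ b ∈ S, G b ^ 2 ≤ Γ) :
    ∫ η, truncSq B S G m η ∂μ ≤
      2 * ∫ η, errorTerm B S (edgesTouching Λ) (B.card * (8 * (Γ / a)))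
        (Γ * (S.card * (A * δ * t / a))) (m / t) η ∂μ := by
  have herror (η : Config d) : 0 ≤ errorTerm B S (edgesTouching Λ) (B.card * (8 * (Γ / a)))
      (Γ * (S.card * (A * δ * t / a))) (m / t) η :=
    errorTerm_nonneg _ _ _ (by positivity) (by positivity) (by positivity) η
  have htrunc (η : Config d) : 0 ≤ truncSq B S G m η :=
    Finset.sum_nonneg fun x _ => le_min (sq_nonneg _) hm
  have hint : Integrable (truncSq B S G m) μ :=
    integrable_finsetSum _ fun x _ => integrable_min_pairing_shift_sq S G hm hinv x
  have h := hμ.lintegral_truncSq_le hne hϱ ha hA hc hδ ht hm hΓ0 hΓ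
  rwa [← ofReal_integral_eq_lintegral_ofReal hint (.of_forall htrunc),
    ← ofReal_integral_eq_lintegral_ofReal (htilt.integrable_errorTerm _ _ _ _ _ _)
      (.of_forall herror), two_mul_ofReal, ENNReal.ofReal_le_ofReal_iff
      (mul_nonneg zero_le_two (integral_nonneg herror))] at h

theorem eventually_forall_norm_le (S : Finset (Edge d)) :
    ∀ᶠ k : ℕ in atTop, ∀ b ∈ S, ‖b.1‖ ≤ k ∧ ‖b.head‖ ≤ k :=
  (Finset.eventually_all S).2 fun _ _ =>
    (tendsto_natCast_atTop_atTop.eventually_ge_atTop _).and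
      (tendsto_natCast_atTop_atTop.eventually_ge_atTop _)

theorem IsGradientGibbs.card_mul_integral_min_pairing_sq_le
    (hμ : IsGradientGibbs (potential ϱ) μ) (hne : ϱ ≠ 0) (hϱ : ∀ᵐ κ ∂ϱ, a ≤ κ ∧ κ ≤ A)
    (ha : 0 < a) (hA : 0 ≤ A) (hinv : IsTranslationInvariant μ) (htilt : HasZeroTilt μ)
    {Λ B : Finset (Site d)} {ξ : Site d → ℝ} {δ t M P : ℝ} (hc : IsCutoff Λ B S ξ δ)
    (hδ : 0 ≤ δ) (ht : 0 < t) (hm : 0 ≤ m) (hΓ0 : 0 < Γ) (hΓ : ∑ b ∈ S, G b ^ 2 ≤ Γ)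
    (hM : ∀ b : Edge d, ∫ η, |η b| ∂μ ≤ M) (hP : ∀ z ∈ Λ, ∫ η, |pathSum z η| ∂μ ≤ P) :
    B.card * ∫ η, min (pairing S G η ^ 2) m ∂μ ≤
      2 * (B.card * (8 * (Γ / a)) + (Γ * (S.card * (A * δ * t / a)) *
        ((edgesTouching Λ).card * M) + m / t * (B.card * (S.card * (P + P))))) := by
  rw [← hinv.integral_truncSq B S G hm]
  refine (hμ.integral_truncSq_le hne hϱ ha hA hinv htilt hc hδ ht hm hΓ0 hΓ).trans ?_
  gcongr
  exact htilt.integral_errorTerm_le _ _ (by positivity) (by positivity) hM fun x hx b hb =>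
    ⟨hP _ (hc.mem_of_mem hx hb).1, hP _ (hc.mem_of_mem hx hb).2⟩

theorem IsGradientGibbs.integral_min_pairing_sq_le_add (hμ : IsGradientGibbs (potential ϱ) μ)
    (hne : ϱ ≠ 0) (hϱ : ∀ᵐ κ ∂ϱ, a ≤ κ ∧ κ ≤ A) (ha : 0 < a)
    (hinv : IsTranslationInvariant μ) (herg : IsErgodic μ) (htilt : HasZeroTilt μ)
    (hm : 0 ≤ m) (hΓ0 : 0 < Γ) (hΓ : ∑ b ∈ S, G b ^ 2 ≤ Γ) :
    ∃ C : ℝ, ∀ ε : ℝ, 0 < ε → ∫ η, min (pairing S G η ^ 2) m ∂μ ≤ 16 * (Γ / a) + C * ε := by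
  have hA : 0 ≤ A := by
    have := NeZero.mk hne
    obtain ⟨κ, hκ⟩ := hϱ.exists
    linarith
  obtain ⟨M, hM0, hM⟩ := hinv.exists_integral_abs_le
  refine ⟨2 * (Γ * (S.card * (A / a))) * (2 * d * 4 ^ d * M) + 16 * m * d * S.card,
    fun ε hε => ?_⟩
  -- On the scale `k` the heights are of order `ε² k`, so truncating them at `2 ε k` makes both
  -- the probability of a truncation and the truncated energy of order `ε`.
  have hgrowth : ∀ᶠ k : ℕ in atTop, ∀ z ∈ box d 0 (8 * k),
      ∫ η, |pathSum z η| ∂μ ≤ d * (ε ^ 2 * (8 * k : ℕ)) :=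
    (tendsto_id.const_mul_atTop' (by norm_num : 0 < 8)).eventually
      (eventually_integral_abs_pathSum_le hμ.loop hinv herg htilt (pow_pos hε 2))
  obtain ⟨k, hP, hS, hk⟩ :=
    (hgrowth.and ((eventually_forall_norm_le S).and (eventually_gt_atTop 0))).exists
  have key := hμ.card_mul_integral_min_pairing_sq_le hne hϱ ha hA hinv htilt (t := ε * (2 * k))
    (isCutoff_box hk hS) (by positivity) (by positivity) hm hΓ0 hΓ hM hP
  have hB : (0 : ℝ) < (box d (3 * k) (5 * k)).card := by
    rw [card_box]
    exact_mod_cast pow_pos (by omega) d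
  have hT : ((edgesTouching (box d 0 (8 * k))).card : ℝ) ≤
      2 * d * 4 ^ d * (box d (3 * k) (5 * k)).card := by
    exact_mod_cast card_edgesTouching_box_le d k
  refine le_of_mul_le_mul_left (key.trans ?_) hB
  calc _ ≤ 2 * ((box d (3 * k) (5 * k)).card * (8 * (Γ / a)) +
        (Γ * (S.card * (A * (1 / (2 * k)) * (ε * (2 * k)) / a)) *
          (2 * d * 4 ^ d * (box d (3 * k) (5 * k)).card * M) +
        m / (ε * (2 * k)) * ((box d (3 * k) (5 * k)).card * (S.card *
          (d * (ε ^ 2 * (8 * k : ℕ)) + d * (ε ^ 2 * (8 * k : ℕ))))))) := by gcongr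
    _ = _ := by push_cast; field_simp; ring

theorem IsGradientGibbs.integral_min_pairing_sq_le (hμ : IsGradientGibbs (potential ϱ) μ)
    (hne : ϱ ≠ 0) (hϱ : ∀ᵐ κ ∂ϱ, a ≤ κ ∧ κ ≤ A) (ha : 0 < a)
    (hinv : IsTranslationInvariant μ) (herg : IsErgodic μ) (htilt : HasZeroTilt μ)
    (S : Finset (Edge d)) (G : Edge d → ℝ) (hm : 0 ≤ m) :
    ∫ η, min (pairing S G η ^ 2) m ∂μ ≤ 16 / a * ∑ b ∈ S, G b ^ 2 := by
  have hpos {Γ : ℝ} (hΓ0 : 0 < Γ) (hΓ : ∑ b ∈ S, G b ^ 2 ≤ Γ) :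
      ∫ η, min (pairing S G η ^ 2) m ∂μ ≤ 16 * (Γ / a) := by
    obtain ⟨C, hC⟩ := hμ.integral_min_pairing_sq_le_add hne hϱ ha hinv herg htilt hm hΓ0 hΓ
    have hlim : Tendsto (fun ε => 16 * (Γ / a) + C * ε) (𝓝[>] 0) (𝓝 (16 * (Γ / a) + C * 0)) :=
      (Continuous.tendsto (by fun_prop) 0).mono_left nhdsWithin_le_nhds
    simpa using ge_of_tendsto hlim (eventually_mem_nhdsWithin.mono hC)
  refine le_of_forall_pos_le_add fun δ hδ => ?_
  refine (hpos (Γ := ∑ b ∈ S, G b ^ 2 + a / 16 * δ) (by positivity)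
    (le_add_of_nonneg_right (by positivity))).trans_eq ?_
  field_simp

theorem iSup_ofReal_min_natCast (x : ℝ) :
    ⨆ n : ℕ, ENNReal.ofReal (min x n) = ENNReal.ofReal x := by
  refine le_antisymm (iSup_le fun n => ENNReal.ofReal_le_ofReal (min_le_left _ _)) ?_
  obtain ⟨n, hn⟩ := exists_nat_ge x
  exact le_iSup_of_le n (by rw [min_eq_left hn])

theorem IsGradientGibbs.lintegral_pairing_sq_le (hμ : IsGradientGibbs (potential ϱ) μ)
    (hne : ϱ ≠ 0) (hϱ : ∀ᵐ κ ∂ϱ, a ≤ κ ∧ κ ≤ A) (ha : 0 < a)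
    (hinv : IsTranslationInvariant μ) (herg : IsErgodic μ) (htilt : HasZeroTilt μ)
    (S : Finset (Edge d)) (G : Edge d → ℝ) :
    ∫⁻ η, ENNReal.ofReal (pairing S G η ^ 2) ∂μ ≤ ENNReal.ofReal (16 / a * ∑ b ∈ S, G b ^ 2) := by
  simp only [← iSup_ofReal_min_natCast (pairing S G _ ^ 2)]
  rw [lintegral_iSup (f := fun n η => ENNReal.ofReal (min (pairing S G η ^ 2) n))
    (fun n => by fun_prop) fun n n' hn η =>
      ENNReal.ofReal_le_ofReal (min_le_min le_rfl (by exact_mod_cast hn))]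
  refine iSup_le fun n => ?_
  have hn : (0 : ℝ) ≤ n := Nat.cast_nonneg n
  rw [← ofReal_integral_eq_lintegral_ofReal (integrable_min_pairing_sq S G hn)
    (.of_forall fun η => le_min (sq_nonneg _) hn)]
  exact ENNReal.ofReal_le_ofReal
    (hμ.integral_min_pairing_sq_le hne hϱ ha hinv herg htilt S G hn)

theorem IsGradientGibbs.eLpNorm_pairing_le (hμ : IsGradientGibbs (potential ϱ) μ)
    (hne : ϱ ≠ 0) (hϱ : ∀ᵐ κ ∂ϱ, a ≤ κ ∧ κ ≤ A) (ha : 0 < a)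
    (hinv : IsTranslationInvariant μ) (herg : IsErgodic μ) (htilt : HasZeroTilt μ)
    (S : Finset (Edge d)) (G : Edge d → ℝ) :
    eLpNorm (pairing S G) 2 μ ≤ ENNReal.ofReal √(16 / a * ∑ b ∈ S, G b ^ 2) := by
  have hsq (η : Config d) :
      ‖pairing S G η‖ₑ ^ (2 : ℝ≥0∞).toReal = ENNReal.ofReal (pairing S G η ^ 2) := by
    rw [ENNReal.toReal_ofNat, Real.enorm_eq_ofReal_abs,
      ENNReal.ofReal_rpow_of_nonneg (abs_nonneg _) zero_le_two, Real.rpow_two, sq_abs]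
  rw [eLpNorm_eq_lintegral_rpow_enorm_toReal two_ne_zero ENNReal.ofNat_ne_top]
  simp only [hsq]
  rw [Real.sqrt_eq_rpow, ← ENNReal.ofReal_rpow_of_nonneg (by positivity) (by norm_num),
    ENNReal.toReal_ofNat]
  gcongr
  exact hμ.lintegral_pairing_sq_le hne hϱ ha hinv herg htilt S G

end Variance

/-! ### Partial derivatives of test functions -/

/-- The partial derivative `∂ᵢ g`. -/
def pderiv (i : Fin d) (g : Eucl d → ℝ) (x : Eucl d) : ℝ :=
  fderiv ℝ g x (EuclideanSpace.basisFun (Fin d) ℝ i)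

section Derivatives

variable {g h : Eucl d → ℝ}

theorem IsTest.isTest_pderiv (hg : IsTest g) (i : Fin d) : IsTest (pderiv i g) where
  smooth := (contDiff_infty_iff_fderiv.1 hg.smooth).2.clm_apply contDiff_const
  compact := hg.compact.fderiv_apply ℝ _

theorem tsupport_pderiv_subset (i : Fin d) (g : Eucl d → ℝ) :
    tsupport (pderiv i g) ⊆ tsupport g :=
  tsupport_fderiv_apply_subset ℝ _

theorem IsTest.integrable (hg : IsTest g) : Integrable g :=
  hg.smooth.continuous.integrable_of_hasCompactSupport hg.compact

theorem IsTest.integrable_laplacian (hg : IsTest g) : Integrable (Δ g) :=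
  hg.lap_continuous.integrable_of_hasCompactSupport hg.lap_compact

theorem IsTest.mul (hg : IsTest g) (hh : IsTest h) : IsTest fun x => g x * h x :=
  ⟨hg.smooth.mul hh.smooth, hg.compact.mul_right⟩

theorem IsTest.sq (hg : IsTest g) : IsTest fun x => g x ^ 2 := by
  simpa only [pow_two] using hg.mul hg

theorem IsTest.integral_mul_pderiv (hg : IsTest g) (hh : IsTest h) (i : Fin d) :
    ∫ x, g x * pderiv i h x = -∫ x, pderiv i g x * h x :=
  integral_mul_fderiv_eq_neg_fderiv_mul_of_integrable
    ((hg.isTest_pderiv i).mul hh).integrable (hg.mul (hh.isTest_pderiv i)).integrable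
    (hg.mul hh).integrable (fun x _ => hg.differentiable x) (fun x _ => hh.differentiable x)

theorem IsTest.pderiv_pderiv_eq_fderiv_fderiv (hg : IsTest g) (i j : Fin d) (x : Eucl d) :
    pderiv i (pderiv j g) x = fderiv ℝ (fderiv ℝ g) x (EuclideanSpace.basisFun (Fin d) ℝ i)
      (EuclideanSpace.basisFun (Fin d) ℝ j) := by
  have hfderiv : Differentiable ℝ (fderiv ℝ g) :=
    (contDiff_infty_iff_fderiv.1 hg.smooth).2.differentiable (by simp)
  change fderiv ℝ (fun y => fderiv ℝ g y (EuclideanSpace.basisFun (Fin d) ℝ j)) x _ = _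
  rw [fderiv_clm_apply (hfderiv x) (differentiableAt_const _)]
  simp

theorem IsTest.pderiv_comm (hg : IsTest g) (i j : Fin d) :
    pderiv i (pderiv j g) = pderiv j (pderiv i g) := by
  funext x
  rw [hg.pderiv_pderiv_eq_fderiv_fderiv, hg.pderiv_pderiv_eq_fderiv_fderiv]
  exact ((hg.two x).isSymmSndFDerivAt (by simp)) _ _

theorem IsTest.laplacian_eq_sum (hg : IsTest g) (x : Eucl d) :
    Δ g x = ∑ i, pderiv i (pderiv i g) x := by
  rw [IsTest.lap_eq]
  refine Finset.sum_congr rfl fun i _ => ?_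
  rw [iteratedFDeriv_two_apply, hg.pderiv_pderiv_eq_fderiv_fderiv]
  simp

theorem norm_gradient_sq (g : Eucl d → ℝ) (x : Eucl d) :
    ‖∇ g x‖ ^ 2 = ∑ i, pderiv i g x ^ 2 := by
  rw [← real_inner_self_eq_norm_sq, ← (EuclideanSpace.basisFun (Fin d) ℝ).sum_inner_mul_inner]
  refine Finset.sum_congr rfl fun i _ => ?_
  rw [inner_gradient_left, inner_gradient_right, pow_two]
  simp [pderiv]

theorem IsTest.integral_pderiv_pderiv_mul_pderiv_pderiv (hg : IsTest g) (i j : Fin d) :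
    ∫ x, pderiv i (pderiv i g) x * pderiv j (pderiv j g) x =
      ∫ x, pderiv i (pderiv j g) x ^ 2 := by
  have hi := hg.isTest_pderiv i
  have hj := hg.isTest_pderiv j
  calc ∫ x, pderiv i (pderiv i g) x * pderiv j (pderiv j g) x
      = -∫ x, pderiv j (pderiv i (pderiv i g)) x * pderiv j g x :=
        (hi.isTest_pderiv i).integral_mul_pderiv hj j
    _ = -∫ x, pderiv j g x * pderiv i (pderiv j (pderiv i g)) x := by
        simp only [hi.pderiv_comm j i, mul_comm]
    _ = ∫ x, pderiv i (pderiv j g) x * pderiv j (pderiv i g) x := by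
        rw [hj.integral_mul_pderiv (hi.isTest_pderiv j) i, neg_neg]
    _ = ∫ x, pderiv i (pderiv j g) x ^ 2 := by simp only [hg.pderiv_comm j i, pow_two]

theorem IsTest.integral_laplacian_sq (hg : IsTest g) :
    ∫ x, Δ g x ^ 2 = ∑ i, ∑ j, ∫ x, pderiv i (pderiv j g) x ^ 2 := by
  have hint (i j : Fin d) :
      Integrable fun x => pderiv i (pderiv i g) x * pderiv j (pderiv j g) x :=
    (((hg.isTest_pderiv i).isTest_pderiv i).mul ((hg.isTest_pderiv j).isTest_pderiv j)).integrable
  simp only [hg.laplacian_eq_sum, pow_two (∑ _, _), Finset.sum_mul_sum]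
  rw [integral_finsetSum _ fun i _ => integrable_finsetSum _ fun j _ => hint i j]
  simp only [integral_finsetSum _ fun j _ => hint _ j,
    hg.integral_pderiv_pderiv_mul_pderiv_pderiv]

theorem IsTest.sum_integral_pderiv_pderiv_sq_le (hg : IsTest g) :
    ∑ i, ∫ x, pderiv i (pderiv i g) x ^ 2 ≤ ∫ x, Δ g x ^ 2 := by
  rw [hg.integral_laplacian_sq]
  exact Finset.sum_le_sum fun i _ =>
    Finset.single_le_sum (f := fun j => ∫ x, pderiv i (pderiv j g) x ^ 2)
      (fun j _ => integral_nonneg fun x => sq_nonneg _) (Finset.mem_univ i)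

theorem IsTest.sum_integral_pderiv_sq_add_le (hg : IsTest g) :
    ∑ i, ∫ x, (pderiv i g x ^ 2 + pderiv i (pderiv i g) x ^ 2) ≤
      ∫ x, (Δ g x ^ 2 + ‖∇ g x‖ ^ 2) := by
  have hfst (i : Fin d) : Integrable fun x => pderiv i g x ^ 2 :=
    (hg.isTest_pderiv i).sq.integrable
  have hsnd (i : Fin d) : Integrable fun x => pderiv i (pderiv i g) x ^ 2 :=
    ((hg.isTest_pderiv i).isTest_pderiv i).sq.integrable
  have hlap : Integrable fun x => Δ g x ^ 2 := by
    simpa only [pow_two] using hg.integrable_mul hg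
  simp only [norm_gradient_sq]
  rw [integral_add hlap (integrable_finsetSum _ fun i _ => hfst i),
    integral_finsetSum _ fun i _ => hfst i]
  simp only [integral_add (hfst _) (hsnd _), Finset.sum_add_distrib]
  linarith [hg.sum_integral_pderiv_pderiv_sq_le]

end Derivatives

/-! ### Integrals over lattice cells -/

/-- The unit cell `z + [0, 1)ᵈ`. -/
def cell (z : Site d) : Set (Eucl d) := {x | floorSite x = z}

theorem mem_cell {z : Site d} {x : Eucl d} :
    x ∈ cell z ↔ ∀ i, (z i : ℝ) ≤ x i ∧ x i < z i + 1 := by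
  simp only [cell, Set.mem_ofPred_eq, funext_iff, floorSite, Int.floor_eq_iff]

theorem fract_of_mem_cell {z : Site d} {x : Eucl d} (hx : x ∈ cell z) (i : Fin d) :
    Int.fract (x i) = x i - z i := by
  rw [Int.fract, Int.floor_eq_iff.2 (mem_cell.1 hx i)]

theorem measurable_floorSite : Measurable (floorSite (d := d)) :=
  measurable_pi_lambda _ fun i => Int.measurable_floor.comp
    (by fun_prop : Continuous fun x : Eucl d => x i).measurable

theorem measurableSet_cell (z : Site d) : MeasurableSet (cell z) :=
  measurable_floorSite (measurableSet_singleton z)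

theorem pairwiseDisjoint_cell (s : Set (Site d)) : s.PairwiseDisjoint cell :=
  fun _ _ _ _ hzw => Set.disjoint_left.2 fun _ hx hy => hzw (hx.symm.trans hy)

theorem toLp_preimage_cell (z : Site d) :
    (MeasurableEquiv.toLp 2 (Fin d → ℝ)).symm.symm ⁻¹' cell z =
      Set.univ.pi fun i => Set.Ico (z i : ℝ) (z i + 1) := by
  ext y
  simp only [Set.mem_preimage, mem_cell, Set.mem_univ_pi, Set.mem_Ico]
  rfl

theorem setIntegral_cell (z : Site d) (f : Eucl d → ℝ) :
    ∫ x in cell z, f x =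
      ∫ y in Set.Icc (fun i => (z i : ℝ)) (fun i => (z i : ℝ) + 1), f (WithLp.toLp 2 y) := by
  have hmp := (EuclideanSpace.volume_preserving_symm_measurableEquiv_toLp (Fin d)).symm
  rw [← hmp.setIntegral_preimage_emb (MeasurableEquiv.measurableEmbedding _), toLp_preimage_cell]
  exact setIntegral_congr_set (by rw [volume_pi]; exact Measure.univ_pi_Ico_ae_eq_Icc)

theorem volume_cell (z : Site d) : volume (cell z) = 1 := by
  have hmp := (EuclideanSpace.volume_preserving_symm_measurableEquiv_toLp (Fin d)).symm
  rw [← hmp.measure_preimage_equiv, toLp_preimage_cell, Real.volume_pi_Ico]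
  simp

instance isProbabilityMeasure_restrict_cell (z : Site d) :
    IsProbabilityMeasure (volume.restrict (cell z)) :=
  ⟨by rw [Measure.restrict_apply_univ, volume_cell]⟩

theorem add_basisFun_mem_cell_iff (z : Site d) (i : Fin d) (x : Eucl d) :
    x + EuclideanSpace.basisFun (Fin d) ℝ i ∈ cell (z + unitVec i) ↔ x ∈ cell z := by
  simp only [mem_cell]
  refine forall_congr' fun j => ?_
  rcases eq_or_ne j i with rfl | hj
  · simp [unitVec]
  · simp [unitVec, hj]

theorem setIntegral_cell_add_unitVec (z : Site d) (i : Fin d) (f : Eucl d → ℝ) :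
    ∫ x in cell (z + unitVec i), f x =
      ∫ x in cell z, f (x + EuclideanSpace.basisFun (Fin d) ℝ i) := by
  rw [← (measurePreserving_add_right volume _).setIntegral_preimage_emb
    (measurableEmbedding_addRight (EuclideanSpace.basisFun (Fin d) ℝ i)) f]
  congr 2
  exact Set.ext (add_basisFun_mem_cell_iff z i)

theorem sum_setIntegral_cell_le {u : Eucl d → ℝ} (hu : Integrable u) (h0 : ∀ x, 0 ≤ u x)
    (Z : Finset (Site d)) : ∑ z ∈ Z, ∫ x in cell z, u x ≤ ∫ x, u x := by
  rw [← integral_biUnion_finset Z (fun z _ => measurableSet_cell z) (pairwiseDisjoint_cell _)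
    fun z _ => hu.integrableOn]
  exact setIntegral_le_integral hu (.of_forall h0)

/-! ### The divergence theorem on a cell -/

theorem setIntegral_Icc_fderiv_eq_zero {n : ℕ} (i : Fin (n + 1)) {a b : Fin (n + 1) → ℝ}
    (hab : a ≤ b) {F : (Fin (n + 1) → ℝ) → ℝ} (hF : ContDiff ℝ 1 F)
    (hface : ∀ y, F (i.insertNth (b i) y) = F (i.insertNth (a i) y)) :
    ∫ y in Set.Icc a b, fderiv ℝ F y (Pi.single i 1) = 0 := by
  have hdiv (y : Fin (n + 1) → ℝ) :
      ∑ j, (fderiv ℝ F y).smulRight (Pi.single i (1 : ℝ)) (Pi.single j 1) j =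
        fderiv ℝ F y (Pi.single i 1) := by
    simp [Pi.single_apply]
  have hcont : Continuous fun y => fderiv ℝ F y (Pi.single i 1) :=
    (hF.continuous_fderiv one_ne_zero).clm_apply continuous_const
  simp only [← hdiv] at hcont ⊢
  rw [integral_divergence_of_hasFDerivAt_off_countable a b hab
    (fun y => F y • Pi.single i (1 : ℝ)) _ ∅ Set.countable_empty
    (hF.continuous.smul continuous_const).continuousOn
    (fun y _ => ((hF.differentiable one_ne_zero y).hasFDerivAt.smul_const _))
    (hcont.continuousOn.integrableOn_compact isCompact_Icc)]
  refine Finset.sum_eq_zero fun j _ => ?_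
  rcases eq_or_ne j i with rfl | hj
  · simp [hface]
  · simp [hj]

theorem setIntegral_cell_pderiv_eq_zero {F : Eucl d → ℝ} (hF : ContDiff ℝ 1 F) (i : Fin d)
    (z : Site d)
    (hface : ∀ x : Eucl d, x i = z i → F (x + EuclideanSpace.basisFun (Fin d) ℝ i) = F x) :
    ∫ x in cell z, pderiv i F x = 0 := by
  obtain ⟨n, rfl⟩ : ∃ n, d = n + 1 := Nat.exists_eq_add_one.2 i.pos
  let L : (Fin (n + 1) → ℝ) →L[ℝ] Eucl (n + 1) :=
    (PiLp.continuousLinearEquiv 2 ℝ (fun _ : Fin (n + 1) => ℝ)).symm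
  have hchain (y : Fin (n + 1) → ℝ) :
      pderiv i F (WithLp.toLp 2 y) = fderiv ℝ (F ∘ L) y (Pi.single i 1) := by
    rw [fderiv_comp y (hF.differentiable one_ne_zero _) L.differentiableAt, L.fderiv, pderiv,
      EuclideanSpace.basisFun_apply]
    rfl
  rw [setIntegral_cell]
  simp only [hchain]
  refine setIntegral_Icc_fderiv_eq_zero i (fun j => by simp) (hF.comp L.contDiff) fun y => ?_
  have htop : L (i.insertNth ((z i : ℝ) + 1) y) =
      L (i.insertNth (z i : ℝ) y) + EuclideanSpace.basisFun (Fin (n + 1)) ℝ i := by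
    ext j
    refine Fin.succAboveCases i ?_ (fun j => ?_) j <;> simp [L]
  rw [Function.comp_apply, htop]
  exact hface _ (by simp [L])

/-- The integral of `k` over the face of `cell z` that is orthogonal to the `i`-th direction and
contains `z`. Integrating `∂ᵢ ((1 - (xᵢ - zᵢ)) k)` over the cell turns it into an integral over
the cell, which needs no surface measure. -/
def faceFlux (i : Fin d) (k : Eucl d → ℝ) (z : Site d) : ℝ :=
  ∫ x in cell z, (k x - (1 - Int.fract (x i)) * pderiv i k x)

section Flux

variable {k : Eucl d → ℝ}

theorem IsTest.integrableOn_fract_mul (hk : IsTest k) (i : Fin d) (z : Site d) :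
    IntegrableOn (fun x => (1 - Int.fract (x i)) * k x) (cell z) := by
  have hmeas : Measurable fun x : Eucl d => 1 - Int.fract (x i) :=
    measurable_const.sub (measurable_fract.comp (by fun_prop : Continuous _).measurable)
  refine hk.integrable.integrableOn.bdd_mul (c := 1) hmeas.aestronglyMeasurable
    (.of_forall fun x => ?_)
  rw [Real.norm_of_nonneg (sub_nonneg.2 (Int.fract_lt_one _).le)]
  exact sub_le_self _ (Int.fract_nonneg _)

theorem IsTest.integrableOn_faceFlux (hk : IsTest k) (i : Fin d) (z : Site d) :
    IntegrableOn (fun x => k x - (1 - Int.fract (x i)) * pderiv i k x) (cell z) :=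
  hk.integrable.integrableOn.sub ((hk.isTest_pderiv i).integrableOn_fract_mul i z)

theorem IsTest.translate (hk : IsTest k) (v : Eucl d) : IsTest fun x => k (x + v) :=
  ⟨hk.smooth.comp (contDiff_id.add contDiff_const),
    hk.compact.comp_homeomorph (Homeomorph.addRight v)⟩

theorem pderiv_translate (i : Fin d) (k : Eucl d → ℝ) (v : Eucl d) :
    pderiv i (fun y => k (y + v)) = fun x => pderiv i k (x + v) := by
  funext x
  simp only [pderiv, fderiv_comp_add_right]

theorem faceFlux_add_unitVec (i : Fin d) (k : Eucl d → ℝ) (z : Site d) :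
    faceFlux i k (z + unitVec i) =
      faceFlux i (fun x => k (x + EuclideanSpace.basisFun (Fin d) ℝ i)) z := by
  simp [faceFlux, setIntegral_cell_add_unitVec, pderiv_translate]

theorem pderiv_interpolation (i : Fin d) (c : ℝ) {u k : Eucl d → ℝ} (hu : Differentiable ℝ u)
    (hk : Differentiable ℝ k) (x : Eucl d) :
    pderiv i (fun x => (c - x i) * (u x - k x) + k x) x =
      (c - x i) * (pderiv i u x - pderiv i k x) - (u x - k x) + pderiv i k x := by
  have hcoord : HasFDerivAt (fun x : Eucl d => c - x i)
      (-(EuclideanSpace.proj i : Eucl d →L[ℝ] ℝ)) x :=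
    (EuclideanSpace.proj i : Eucl d →L[ℝ] ℝ).hasFDerivAt.const_sub c
  have h := (hcoord.fun_mul ((hu x).hasFDerivAt.fun_sub (hk x).hasFDerivAt)).fun_add
    (hk x).hasFDerivAt
  rw [pderiv, h.fderiv]
  simp [pderiv]
  ring

/-- Apply `setIntegral_cell_pderiv_eq_zero` to the interpolation
`(1 - (xᵢ - zᵢ)) (k (x + eᵢ) - k x) + k x`, whose values at both ends of a segment of the cell in
the direction `i` are the value of `k` at the upper end. -/
theorem IsTest.setIntegral_cell_pderiv (hk : IsTest k) (i : Fin d) (z : Site d) :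
    ∫ x in cell z, pderiv i k x = faceFlux i k (z + unitVec i) - faceFlux i k z := by
  let u : Eucl d → ℝ := fun x => k (x + EuclideanSpace.basisFun (Fin d) ℝ i)
  have hu : IsTest u := hk.translate _
  let F : Eucl d → ℝ := fun x => ((z i + 1 : ℝ) - x i) * (u x - k x) + k x
  have hF : ContDiff ℝ 1 F := by
    have hk1 : ContDiff ℝ 1 k := hk.smooth.of_le (by simp)
    have hu1 : ContDiff ℝ 1 u := hu.smooth.of_le (by simp)
    fun_prop
  have hface (x : Eucl d) (hx : x i = z i) :
      F (x + EuclideanSpace.basisFun (Fin d) ℝ i) = F x := by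
    simp [F, u, hx]
  have hpderiv (x : Eucl d) (hx : x ∈ cell z) :
      pderiv i F x = pderiv i k x - ((u x - (1 - Int.fract (x i)) * pderiv i u x) -
        (k x - (1 - Int.fract (x i)) * pderiv i k x)) := by
    rw [pderiv_interpolation i _ hu.differentiable hk.differentiable, fract_of_mem_cell hx]
    ring
  have hflux := (hu.integrableOn_faceFlux i z).fun_sub (hk.integrableOn_faceFlux i z)
  rw [faceFlux_add_unitVec, ← sub_eq_zero, faceFlux, faceFlux,
    ← integral_sub (hu.integrableOn_faceFlux i z) (hk.integrableOn_faceFlux i z),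
    ← integral_sub (hk.isTest_pderiv i).integrable.integrableOn hflux,
    ← setIntegral_congr_fun (measurableSet_cell z) hpderiv]
  exact setIntegral_cell_pderiv_eq_zero hF i z hface

end Flux

/-! ### The Laplacian as a pairing with edge weights -/

theorem sq_integral_le_integral_of_sq_le {Ω : Type*} [MeasurableSpace Ω] {μ : Measure Ω}
    [IsProbabilityMeasure μ] {f g : Ω → ℝ} (hf : Integrable f μ) (hg : Integrable g μ)
    (hfg : ∀ x, f x ^ 2 ≤ g x) : (∫ x, f x ∂μ) ^ 2 ≤ ∫ x, g x ∂μ := by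
  set m := ∫ x, f x ∂μ with hm
  calc m ^ 2 = ∫ x, (2 * m * f x - m ^ 2) ∂μ := by
        rw [integral_sub (hf.const_mul _) (integrable_const _), integral_const_mul, ← hm]
        simp
        ring
    _ ≤ ∫ x, g x ∂μ := integral_mono ((hf.const_mul _).sub (integrable_const _)) hg fun x => by
        dsimp only
        linarith [hfg x, sq_nonneg (f x - m)]

section Representation

variable {g k : Eucl d → ℝ} {Z : Finset (Site d)}

theorem IsTest.sq_faceFlux_le (hk : IsTest k) (i : Fin d) (z : Site d) :
    faceFlux i k z ^ 2 ≤ ∫ x in cell z, 2 * (k x ^ 2 + pderiv i k x ^ 2) := by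
  refine sq_integral_le_integral_of_sq_le (hk.integrableOn_faceFlux i z)
    ((hk.sq.integrable.add (hk.isTest_pderiv i).sq.integrable).const_mul 2).integrableOn fun x => ?_
  have hfract : (1 - Int.fract (x i)) ^ 2 ≤ 1 :=
    pow_le_one₀ (sub_nonneg.2 (Int.fract_lt_one _).le) (sub_le_self _ (Int.fract_nonneg _))
  have hmul := mul_le_of_le_one_left (sq_nonneg (pderiv i k x)) hfract
  linarith [sq_nonneg (k x + (1 - Int.fract (x i)) * pderiv i k x)]

theorem IsTest.sum_sq_faceFlux_le (hk : IsTest k) (i : Fin d) (Z : Finset (Site d)) :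
    ∑ z ∈ Z, faceFlux i k z ^ 2 ≤ 2 * ∫ x, (k x ^ 2 + pderiv i k x ^ 2) := by
  rw [← integral_const_mul]
  exact (Finset.sum_le_sum fun z _ => hk.sq_faceFlux_le i z).trans
    (sum_setIntegral_cell_le
      ((hk.sq.integrable.add (hk.isTest_pderiv i).sq.integrable).const_mul 2)
      (fun _ => mul_nonneg zero_le_two (add_nonneg (sq_nonneg _) (sq_nonneg _))) Z)

theorem IsTest.exists_forall_mem_tsupport_floorSite_mem (hg : IsTest g) :
    ∃ Z : Finset (Site d), ∀ x ∈ tsupport g, floorSite x ∈ Z := by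
  obtain ⟨R, hR⟩ := hg.compact.isCompact.isBounded.exists_norm_le
  refine ⟨Finset.Icc (fun _ => ⌊-R⌋) (fun _ => ⌊R⌋), fun x hx => ?_⟩
  have hcoord (i : Fin d) : |x i| ≤ R := (PiLp.norm_apply_le x i).trans (hR x hx)
  exact Finset.mem_Icc.2 ⟨fun i => Int.floor_le_floor (abs_le.1 (hcoord i)).1,
    fun i => Int.floor_le_floor (abs_le.1 (hcoord i)).2⟩

theorem eq_zero_of_floorSite_notMem (hZ : ∀ x ∈ tsupport k, floorSite x ∈ Z) {x : Eucl d}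
    (hx : floorSite x ∉ Z) : k x = 0 :=
  image_eq_zero_of_notMem_tsupport fun h => hx (hZ x h)

theorem forall_mem_tsupport_pderiv (hZ : ∀ x ∈ tsupport k, floorSite x ∈ Z) (i : Fin d) :
    ∀ x ∈ tsupport (pderiv i k), floorSite x ∈ Z :=
  fun x hx => hZ x (tsupport_pderiv_subset i k hx)

theorem faceFlux_eq_zero (hZ : ∀ x ∈ tsupport k, floorSite x ∈ Z) (i : Fin d) {z : Site d}
    (hz : z ∉ Z) : faceFlux i k z = 0 := by
  refine setIntegral_eq_zero_of_forall_eq_zero fun x hx => ?_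
  have hx' : floorSite x ∉ Z := by rwa [show floorSite x = z from hx]
  rw [eq_zero_of_floorSite_notMem hZ hx',
    eq_zero_of_floorSite_notMem (forall_mem_tsupport_pderiv hZ i) hx', mul_zero, sub_zero]

theorem IsTest.faceFlux_add_unitVec_eq_zero (hk : IsTest k)
    (hZ : ∀ x ∈ tsupport k, floorSite x ∈ Z) (i : Fin d) {z : Site d} (hz : z ∉ Z) :
    faceFlux i k (z + unitVec i) = 0 := by
  have hcell : ∫ x in cell z, pderiv i k x = 0 := by
    refine setIntegral_eq_zero_of_forall_eq_zero fun x hx =>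
      eq_zero_of_floorSite_notMem (forall_mem_tsupport_pderiv hZ i) ?_
    rwa [show floorSite x = z from hx]
  rwa [hk.setIntegral_cell_pderiv, faceFlux_eq_zero hZ i hz, sub_zero] at hcell

theorem IsTest.laplacian_eq_zero_of_floorSite_notMem (hg : IsTest g)
    (hZ : ∀ x ∈ tsupport g, floorSite x ∈ Z) {x : Eucl d} (hx : floorSite x ∉ Z) :
    Δ g x = 0 := by
  rw [hg.laplacian_eq_sum]
  exact Finset.sum_eq_zero fun i _ => eq_zero_of_floorSite_notMem
    (forall_mem_tsupport_pderiv (forall_mem_tsupport_pderiv hZ i) i) hx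

theorem IsTest.setIntegral_cell_laplacian (hg : IsTest g) (z : Site d) :
    ∫ x in cell z, Δ g x =
      ∑ i, (faceFlux i (pderiv i g) (z + unitVec i) - faceFlux i (pderiv i g) z) := by
  simp only [hg.laplacian_eq_sum]
  rw [integral_finsetSum _ fun i _ =>
    ((hg.isTest_pderiv i).isTest_pderiv i).integrable.integrableOn]
  simp only [(hg.isTest_pderiv _).setIntegral_cell_pderiv]

theorem mul_comp_floorSite_eq_sum_indicator (hk : ∀ x, floorSite x ∉ Z → k x = 0)
    (φ : Site d → ℝ) (x : Eucl d) :
    k x * φ (floorSite x) = ∑ z ∈ Z, (cell z).indicator (fun x => φ z * k x) x := by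
  by_cases hx : floorSite x ∈ Z
  · simp [Set.indicator_apply, cell, hx, mul_comm]
  · rw [hk x hx, zero_mul, Finset.sum_eq_zero fun z _ => ?_]
    simp [hk x hx]

theorem integrable_mul_comp_floorSite (hk : ∀ x, floorSite x ∉ Z → k x = 0) (hint : Integrable k)
    (φ : Site d → ℝ) : Integrable fun x => k x * φ (floorSite x) := by
  simp only [mul_comp_floorSite_eq_sum_indicator hk]
  exact integrable_finsetSum _ fun z _ => (hint.const_mul _).indicator (measurableSet_cell z)

theorem integral_mul_comp_floorSite (hk : ∀ x, floorSite x ∉ Z → k x = 0) (hint : Integrable k)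
    (φ : Site d → ℝ) :
    ∫ x, k x * φ (floorSite x) = ∑ z ∈ Z, φ z * ∫ x in cell z, k x := by
  simp only [mul_comp_floorSite_eq_sum_indicator hk]
  rw [integral_finsetSum _ fun z _ => (hint.const_mul _).indicator (measurableSet_cell z)]
  simp only [integral_indicator (measurableSet_cell _), integral_const_mul]

theorem sum_mul_sub_eq_sum_sub_mul {v : Site d} {u : Site d → ℝ} (hu : ∀ z ∉ Z, u z = 0)
    (hv : ∀ z ∉ Z, u (z + v) = 0) (φ : Site d → ℝ) :
    ∑ z ∈ Z, φ z * (u (z + v) - u z) = ∑ z ∈ Z, (φ (z - v) - φ z) * u z := by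
  have hshift : ∑ z ∈ Z, φ z * u (z + v) = ∑ z ∈ Z, φ (z - v) * u z := by
    calc ∑ z ∈ Z, φ z * u (z + v)
        = ∑' z, φ z * u (z + v) := (tsum_eq_sum fun z hz => by rw [hv z hz, mul_zero]).symm
      _ = ∑' z, φ (z - v) * u z := by
          rw [← (Equiv.addRight v).tsum_eq fun z => φ (z - v) * u z]
          simp only [Equiv.coe_addRight, add_sub_cancel_right]
      _ = ∑ z ∈ Z, φ (z - v) * u z := tsum_eq_sum fun z hz => by rw [hu z hz, mul_zero]
  simp only [mul_sub, sub_mul, Finset.sum_sub_distrib, hshift]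

open Classical in
/-- The positively oriented edges with head in `Z`. -/
def edgesInto (Z : Finset (Site d)) : Finset (Edge d) :=
  (Z ×ˢ Finset.univ).image fun p => (p.1 - unitVec p.2, p.2)

theorem sum_edgesInto (Z : Finset (Site d)) (f : Edge d → ℝ) :
    ∑ b ∈ edgesInto Z, f b = ∑ i, ∑ z ∈ Z, f (z - unitVec i, i) := by
  have hinj : Function.Injective fun p : Edge d => ((p.1 - unitVec p.2, p.2) : Edge d) := by
    rintro ⟨z, i⟩ ⟨w, j⟩ h
    obtain ⟨hsub, rfl⟩ : z - unitVec i = w - unitVec j ∧ i = j := Prod.mk.inj h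
    rw [sub_left_injective hsub]
  rw [edgesInto, Finset.sum_image hinj.injOn, Finset.sum_product_right]

/-- The coefficient of `η b` in `φ(Δ g)`: the flux of `-∇ g` through the face orthogonal to `b` of
the cell at the head of `b`. -/
def laplacianWeight (g : Eucl d → ℝ) (b : Edge d) : ℝ := -faceFlux b.2 (pderiv b.2 g) b.head

theorem IsTest.sum_sq_laplacianWeight_le (hg : IsTest g) (Z : Finset (Site d)) :
    ∑ b ∈ edgesInto Z, laplacianWeight g b ^ 2 ≤ 2 * ∫ x, (Δ g x ^ 2 + ‖∇ g x‖ ^ 2) := by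
  simp only [sum_edgesInto, laplacianWeight, Edge.head, sub_add_cancel, neg_sq]
  calc ∑ i, ∑ z ∈ Z, faceFlux i (pderiv i g) z ^ 2
      ≤ ∑ i, 2 * ∫ x, (pderiv i g x ^ 2 + pderiv i (pderiv i g) x ^ 2) :=
        Finset.sum_le_sum fun i _ => (hg.isTest_pderiv i).sum_sq_faceFlux_le i Z
    _ ≤ 2 * ∫ x, (Δ g x ^ 2 + ‖∇ g x‖ ^ 2) := by
        rw [← Finset.mul_sum]
        gcongr
        exact hg.sum_integral_pderiv_sq_add_le

theorem IsTest.fieldAt_laplacian_eq_pairing (hg : IsTest g)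
    (hZ : ∀ x ∈ tsupport g, floorSite x ∈ Z) {η : Config d} (hη : LoopCondition η) :
    fieldAt (Δ g) η = pairing (edgesInto Z) (laplacianWeight g) η := by
  have hsupp (i : Fin d) := forall_mem_tsupport_pderiv hZ i
  calc fieldAt (Δ g) η
      = ∑ z ∈ Z, height η z * ∫ x in cell z, Δ g x :=
        integral_mul_comp_floorSite (fun x => hg.laplacian_eq_zero_of_floorSite_notMem hZ)
          hg.integrable_laplacian _
    _ = ∑ i, ∑ z ∈ Z, height η z *
          (faceFlux i (pderiv i g) (z + unitVec i) - faceFlux i (pderiv i g) z) := by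
        simp only [hg.setIntegral_cell_laplacian, Finset.mul_sum]
        exact Finset.sum_comm
    _ = ∑ i, ∑ z ∈ Z, (height η (z - unitVec i) - height η z) * faceFlux i (pderiv i g) z :=
        Finset.sum_congr rfl fun i _ => sum_mul_sub_eq_sum_sub_mul
          (fun z => faceFlux_eq_zero (hsupp i) i)
          (fun z => (hg.isTest_pderiv i).faceFlux_add_unitVec_eq_zero (hsupp i) i) _
    _ = pairing (edgesInto Z) (laplacianWeight g) (grad (height η)) := by
        simp only [pairing, sum_edgesInto, laplacianWeight, grad, Edge.head, sub_add_cancel]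
        exact Finset.sum_congr rfl fun i _ => Finset.sum_congr rfl fun z _ => by ring
    _ = pairing (edgesInto Z) (laplacianWeight g) η := by rw [hη.height_spec.2]

end Representation

section H0

theorem H0.integrable_mul_comp_floorSite (f : H0 d) (φ : Site d → ℝ) :
    Integrable fun x => f.fn x * φ (floorSite x) := by
  obtain ⟨Z, hZ⟩ := f.isTest.exists_forall_mem_tsupport_floorSite_mem
  rw [← f.lap_invLap]
  exact GradientField.integrable_mul_comp_floorSite
    (fun x => f.isTest.laplacian_eq_zero_of_floorSite_notMem hZ) f.isTest.integrable_laplacian φ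

theorem H0.fieldAt_add (f h : H0 d) : fieldAt (f + h).fn = fieldAt f.fn + fieldAt h.fn := by
  funext η
  simp only [fieldAt, H0.fn_add, Pi.add_apply, add_mul]
  exact integral_add (f.integrable_mul_comp_floorSite _) (h.integrable_mul_comp_floorSite _)

theorem H0.fieldAt_smul (c : ℝ) (f : H0 d) : fieldAt (c • f).fn = c • fieldAt f.fn := by
  funext η
  simp only [fieldAt, H0.fn_smul, Pi.smul_apply, smul_eq_mul, mul_assoc]
  exact integral_const_mul _ _

theorem H0.norm_sq_eq (f : H0 d) :
    ‖f‖ ^ 2 = ∫ x, (Δ f.invLap x ^ 2 + ‖∇ f.invLap x‖ ^ 2) := by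
  rw [H0.norm_eq f f.invLap f.isTest f.lap_invLap, Real.sq_sqrt]
  exact integral_nonneg fun x => by positivity

end H0

section Main

variable {μ : Measure (Config d)}

theorem IsGradientGibbs.memLp_and_eLpNorm_fieldAt_le [IsProbabilityMeasure μ] {ϱ : Measure ℝ}
    [IsFiniteMeasure ϱ] {a A : ℝ} (hμ : IsGradientGibbs (potential ϱ) μ) (hne : ϱ ≠ 0)
    (hϱ : ∀ᵐ κ ∂ϱ, a ≤ κ ∧ κ ≤ A) (ha : 0 < a) (hinv : IsTranslationInvariant μ)
    (herg : IsErgodic μ) (htilt : HasZeroTilt μ) (f : H0 d) :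
    MemLp (fieldAt f.fn) 2 μ ∧
      eLpNorm (fieldAt f.fn) 2 μ ≤ ENNReal.ofReal (√(32 / a) * ‖f‖) := by
  obtain ⟨Z, hZ⟩ := f.isTest.exists_forall_mem_tsupport_floorSite_mem
  set S := edgesInto Z
  set G := laplacianWeight f.invLap
  have hpair : fieldAt f.fn =ᵐ[μ] pairing S G := by
    filter_upwards [hμ.loop] with η hη
    rw [← f.lap_invLap, f.isTest.fieldAt_laplacian_eq_pairing hZ hη]
  have hG : ∑ b ∈ S, G b ^ 2 ≤ 2 * ‖f‖ ^ 2 := by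
    rw [f.norm_sq_eq]
    exact f.isTest.sum_sq_laplacianWeight_le Z
  have hconst : √(16 / a * ∑ b ∈ S, G b ^ 2) ≤ √(32 / a) * ‖f‖ := by
    calc √(16 / a * ∑ b ∈ S, G b ^ 2) ≤ √(16 / a * (2 * ‖f‖ ^ 2)) := by gcongr
      _ = √(32 / a * ‖f‖ ^ 2) := by ring_nf
      _ = √(32 / a) * ‖f‖ := by
          rw [Real.sqrt_mul (by positivity), Real.sqrt_sq (norm_nonneg f)]
  have hle : eLpNorm (pairing S G) 2 μ ≤ ENNReal.ofReal (√(32 / a) * ‖f‖) :=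
    (hμ.eLpNorm_pairing_le hne hϱ ha hinv herg htilt S G).trans
      (ENNReal.ofReal_le_ofReal hconst)
  rw [memLp_congr_ae hpair, eLpNorm_congr_ae hpair]
  exact ⟨⟨(measurable_pairing S G).aestronglyMeasurable, hle.trans_lt ENNReal.ofReal_lt_top⟩, hle⟩

theorem existsUnique_continuousLinearMap_completion {E F : Type*} [NormedAddCommGroup E]
    [NormedSpace ℝ E] [NormedAddCommGroup F] [NormedSpace ℝ F] [CompleteSpace F] (L : E →L[ℝ] F) :
    ∃! Φ : UniformSpace.Completion E →L[ℝ] F, ∀ x : E, Φ x = L x := by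
  have hind : IsUniformInducing (UniformSpace.Completion.toComplL : E →L[ℝ] _) :=
    UniformSpace.Completion.isUniformInducing_coe E
  have hdense : DenseRange (UniformSpace.Completion.toComplL : E →L[ℝ] _) :=
    UniformSpace.Completion.denseRange_coe
  exact ⟨L.extend UniformSpace.Completion.toComplL, L.extend_eq hdense hind,
    fun Ψ hΨ => (L.extend_unique hdense hind Ψ (ContinuousLinearMap.ext hΨ)).symm⟩

/-- The linear map `f ↦ φ(f)` from `H₀` to `L²(μ)`. -/
def fieldAtL2 (h : ∀ f : H0 d, MemLp (fieldAt f.fn) 2 μ) : H0 d →ₗ[ℝ] Lp ℝ 2 μ where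
  toFun f := (h f).toLp
  map_add' f k := by
    rw [← MemLp.toLp_add]
    exact MemLp.toLp_congr _ _ (by rw [H0.fieldAt_add])
  map_smul' r f := by
    rw [RingHom.id_apply, ← MemLp.toLp_const_smul]
    exact MemLp.toLp_congr _ _ (by rw [H0.fieldAt_smul])

theorem existsUnique_extension_fieldAt {c : ℝ} (h : ∀ f : H0 d, MemLp (fieldAt f.fn) 2 μ ∧
      eLpNorm (fieldAt f.fn) 2 μ ≤ ENNReal.ofReal (c * ‖f‖)) :
    ∃! Φ : H d →L[ℝ] Lp ℝ 2 μ, ∀ f : H0 d, Φ (f : H d) =ᵐ[μ] fieldAt f.fn := by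
  have hbound (f : H0 d) : ‖fieldAtL2 (fun f => (h f).1) f‖ ≤ max c 0 * ‖f‖ := by
    refine (Lp.norm_toLp _ (h f).1).trans_le ?_
    refine ENNReal.toReal_le_of_le_ofReal (by positivity) ((h f).2.trans ?_)
    gcongr
    exact le_max_left _ _
  have hae (Φ : H d →L[ℝ] Lp ℝ 2 μ) (f : H0 d) :
      Φ f =ᵐ[μ] fieldAt f.fn ↔ Φ f = LinearMap.mkContinuous _ _ hbound f :=
    ⟨fun hΦ => Lp.ext (hΦ.trans (h f).1.coeFn_toLp.symm),
      fun hΦ => (Lp.ext_iff.1 hΦ).trans (h f).1.coeFn_toLp⟩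
  simp only [hae]
  exact existsUnique_continuousLinearMap_completion _

end Main

end GradientField

end

theorem lemma2p2 {d : ℕ} (hd : 0 < d)
    (ϱ : MeasureTheory.Measure ℝ) [MeasureTheory.IsFiniteMeasure ϱ] (hϱ : ϱ ≠ 0)
    (hcompact : IsCompact ϱ.support)
    (hpos : ∃ a : ℝ, 0 < a ∧ ∀ κ ∈ ϱ.support, a ≤ κ)
    (μ : MeasureTheory.Measure (GradientField.Config d)) [MeasureTheory.IsProbabilityMeasure μ]
    (hgibbs : GradientField.IsGradientGibbs (GradientField.potential ϱ) μ)
    (hinv : GradientField.IsTranslationInvariant μ)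
    (herg : GradientField.IsErgodic μ)
    (htilt : GradientField.HasZeroTilt μ) :
    (∃ c : ℝ, ∀ f : GradientField.H0 d,
      MeasureTheory.MemLp (GradientField.fieldAt f.fn) 2 μ ∧
      MeasureTheory.eLpNorm (GradientField.fieldAt f.fn) 2 μ ≤ ENNReal.ofReal (c * ‖f‖)) ∧
    ∃! Φ : GradientField.H d →L[ℝ] MeasureTheory.Lp ℝ 2 μ,
      ∀ f : GradientField.H0 d,
        Φ (f : GradientField.H d) =ᵐ[μ] GradientField.fieldAt f.fn := by
  obtain ⟨a, ha, hsupp⟩ := hpos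
  obtain ⟨A, hA⟩ := hcompact.isBounded.exists_norm_le
  have hae : ∀ᵐ κ ∂ϱ, a ≤ κ ∧ κ ≤ A := by
    filter_upwards [MeasureTheory.Measure.support_mem_ae (μ := ϱ)] with κ hκ
    exact ⟨hsupp κ hκ, (le_abs_self κ).trans (hA κ hκ)⟩
  have hbound := hgibbs.memLp_and_eLpNorm_fieldAt_le hϱ hae ha hinv herg htilt
  exact ⟨⟨_, hbound⟩, GradientField.existsUnique_extension_fieldAt hbound⟩
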